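/- An instance $(G,s)$ of \textsc{Telephone Broadcasting} consists of a connected, undirected, unweighted graph $G$ on $n$ vertices and a source $s\in V(G)$, which is initially the only informed vertex. In each synchronous round, every informed vertex may call (and thereby inform) at most one uninformed neighbour, and no vertex is called by two vertices in the same round. A broadcast scheme with $r$ rounds is a choice of calls for $r$ such rounds after which all vertices are informed; $br^*(G,s)$ is the least possible number of rounds, and a scheme with $br^*(G,s)$ rounds is optimal. An ordering with bandwidth $k$ of $G$ is a permutation $v_1,\dots,v_n$ of the vertices such that $|i-j|\le k$ for every edge $v_iv_j$; the bandwidth of $G$ is the least $k$ for which such an ordering exists. Running times are counted in steps of a random access machine with unit-cost addition, truncated subtraction, indirect loads and stores, and zero tests. (1) There are an algorithm, a function $f:\mathbb N\to\mathbb N$ and a constant $C$ such that for every $k\ge 0$ and every instance $(G,s)$, given (by adjacency matrix) together with an ordering of $G$ with bandwidth $k$, the algorithm outputs $br^*(G,s)$ and an optimal broadcast scheme in at most $f(k)\cdot n^{k^2+Ck}$ steps, i.e. in time $f(k)\cdot n^{k^2+O(k)}$. (2) In particular, for every constant $k$ there is an algorithm which, given an instance $(G,s)$ in which $G$ has bandwidth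 at most $k$ (without an ordering), outputs $br^*(G,s)$ and an optimal broadcast scheme in time polynomial in $n$. -/

import Mathlib

namespace TelephoneBroadcast

/-! ## Telephone broadcasting -/

section Broadcasting

variable {V : Type*}

/-- A calling pattern: `c t u = some v` means that in round `t` (rounds are numbered from `0`)
vertex `u` calls vertex `v`; `c t u = none` means that `u` makes no call in round `t`. -/
abbrev Calls (V : Type*) := ℕ → V → Option V

/-- The set of vertices that are informed after the first `t` rounds, if initially only the
source `s` is informed. -/
def informed (s : V) (c : Calls V) : ℕ → Set V
  | 0 => {s}
  | t + 1 => informed s c t ∪ {v | ∃ u ∈ informed s c t, c t u = some v}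

/-- `c` is a broadcast scheme for `(G, s)` with `r` rounds: in each of the first `r` rounds, calls
are only made by informed vertices to uninformed neighbours (at most one call per caller, since
`c t` is a function), no vertex is called twice in one round, and after `r` rounds all vertices
are informed. -/
structure IsScheme (G : SimpleGraph V) (s : V) (r : ℕ) (c : Calls V) : Prop where
  caller_informed : ∀ t < r, ∀ u v, c t u = some v → u ∈ informed s c t
  callee_uninformed : ∀ t < r, ∀ u v, c t u = some v → v ∉ informed s c t
  adj : ∀ t < r, ∀ u v, c t u = some v → G.Adj u v
  one_caller : ∀ t < r, ∀ u u' v, c t u = some v → c t u' = some v → u = u'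
  all_informed : informed s c r = Set.univ

/-- The optimal broadcast time of `G` when the originator is `s`. -/
noncomputable def broadcastTime (G : SimpleGraph V) (s : V) : ℕ :=
  sInf {r | ∃ c : Calls V, IsScheme G s r c}

end Broadcasting

/-! ## Bandwidth -/

/-- The permutation `v 0, …, v (n - 1)` of the vertices is an ordering of `G` with
bandwidth `k`. -/
def IsBandwidthOrdering {n : ℕ} (G : SimpleGraph (Fin n)) (k : ℕ) (v : Equiv.Perm (Fin n)) :
    Prop :=
  ∀ i j : Fin n, G.Adj (v i) (v j) → |(i : ℤ) - (j : ℤ)| ≤ (k : ℤ)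

/-- The bandwidth of `G`: the minimum `k` such that an ordering with bandwidth `k` exists. -/
noncomputable def bandwidth {n : ℕ} (G : SimpleGraph (Fin n)) : ℕ :=
  sInf {k | ∃ v : Equiv.Perm (Fin n), IsBandwidthOrdering G k v}

/-! ## Random access machines

Registers and memory cells hold natural numbers. The only arithmetic is addition and truncated
subtraction (no multiplication); every elementary operation and every test costs one step. -/

/-- Structured programs of the random access machine. -/
inductive Prog : Type
  /-- `reg d := c` -/
  | const (d c : ℕ)
  /-- `reg d := reg a + reg b` -/
  | add (d a b : ℕ)
  /-- `reg d := reg a - reg b` (truncated at `0`) -/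
  | sub (d a b : ℕ)
  /-- `reg d := mem (reg a)` -/
  | load (d a : ℕ)
  /-- `mem (reg a) := reg b` -/
  | store (a b : ℕ)
  /-- first `p`, then `q` -/
  | seq (p q : Prog)
  /-- if `reg a ≠ 0` then `p` else `q` -/
  | ite (a : ℕ) (p q : Prog)
  /-- while `reg a ≠ 0` do `p` -/
  | loop (a : ℕ) (p : Prog)

/-- A configuration of the machine: contents of the registers and of the memory. -/
@[ext]
structure Config : Type where
  reg : ℕ → ℕ
  mem : ℕ → ℕ

/-- Overwriting one register. -/
def Config.setReg (σ : Config) (d x : ℕ) : Config := ⟨Function.update σ.reg d x, σ.mem⟩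

/-- Overwriting one memory cell. -/
def Config.setMem (σ : Config) (a x : ℕ) : Config := ⟨σ.reg, Function.update σ.mem a x⟩

/-- `Exec p σ τ t`: started in configuration `σ`, the program `p` halts in configuration `τ` after
exactly `t` steps. -/
inductive Exec : Prog → Config → Config → ℕ → Prop
  | const (σ : Config) (d c : ℕ) : Exec (.const d c) σ (σ.setReg d c) 1
  | add (σ : Config) (d a b : ℕ) : Exec (.add d a b) σ (σ.setReg d (σ.reg a + σ.reg b)) 1
  | sub (σ : Config) (d a b : ℕ) : Exec (.sub d a b) σ (σ.setReg d (σ.reg a - σ.reg b)) 1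
  | load (σ : Config) (d a : ℕ) : Exec (.load d a) σ (σ.setReg d (σ.mem (σ.reg a))) 1
  | store (σ : Config) (a b : ℕ) : Exec (.store a b) σ (σ.setMem (σ.reg a) (σ.reg b)) 1
  | seq {p q : Prog} {σ τ υ : Config} {t t' : ℕ} :
      Exec p σ τ t → Exec q τ υ t' → Exec (.seq p q) σ υ (t + t')
  | ite_true {a : ℕ} {p q : Prog} {σ τ : Config} {t : ℕ} :
      σ.reg a ≠ 0 → Exec p σ τ t → Exec (.ite a p q) σ τ (t + 1)
  | ite_false {a : ℕ} {p q : Prog} {σ τ : Config} {t : ℕ} :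
      σ.reg a = 0 → Exec q σ τ t → Exec (.ite a p q) σ τ (t + 1)
  | loop_done {a : ℕ} {p : Prog} {σ : Config} :
      σ.reg a = 0 → Exec (.loop a p) σ σ 1
  | loop_step {a : ℕ} {p : Prog} {σ τ υ : Config} {t t' : ℕ} :
      σ.reg a ≠ 0 → Exec p σ τ t → Exec (.loop a p) τ υ t' → Exec (.loop a p) σ υ (t + t' + 1)

/-- The machine is deterministic: the final configuration and the number of steps are unique. -/
theorem Exec.det {p : Prog} {σ τ τ' : Config} {t t' : ℕ} (h : Exec p σ τ t)
    (h' : Exec p σ τ' t') : τ = τ' ∧ t = t' := by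
  induction h generalizing τ' t' with
  | const | add | sub | load | store => cases h'; exact ⟨rfl, rfl⟩
  | seq _ _ ih₁ ih₂ =>
    cases h' with
    | seq h₁ h₂ =>
      obtain ⟨rfl, rfl⟩ := ih₁ h₁
      obtain ⟨rfl, rfl⟩ := ih₂ h₂
      exact ⟨rfl, rfl⟩
  | ite_true ha _ ih =>
    cases h' with
    | ite_true _ h₁ => obtain ⟨rfl, rfl⟩ := ih h₁; exact ⟨rfl, rfl⟩
    | ite_false hb _ => exact absurd hb ha
  | ite_false ha _ ih =>
    cases h' with
    | ite_true hb _ => exact absurd ha hb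
    | ite_false _ h₁ => obtain ⟨rfl, rfl⟩ := ih h₁; exact ⟨rfl, rfl⟩
  | loop_done ha =>
    cases h' with
    | loop_done _ => exact ⟨rfl, rfl⟩
    | loop_step hb _ _ => exact absurd ha hb
  | loop_step ha _ _ ih₁ ih₂ =>
    cases h' with
    | loop_done hb => exact absurd hb ha
    | loop_step _ h₁ h₂ =>
      obtain ⟨rfl, rfl⟩ := ih₁ h₁
      obtain ⟨rfl, rfl⟩ := ih₂ h₂
      exact ⟨rfl, rfl⟩

/-- The initial configuration: the input is written in memory cells `0, 1, 2, …`; all other cells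
and all registers are `0`. -/
def initConfig (input : List ℕ) : Config := ⟨fun _ => 0, fun a => input.getD a 0⟩

/-! ## Input and output of the algorithms -/

open Classical in
/-- The instance `(G, s)` as a list of numbers: `n`, `s`, and the adjacency matrix of `G`, row by
row. -/
noncomputable def encodeInstance {n : ℕ} (G : SimpleGraph (Fin n)) (s : Fin n) : List ℕ :=
  [n, (s : ℕ)] ++ List.ofFn (fun e : Fin (n * n) => if G.Adj e.divNat e.modNat then 1 else 0)

/-- The list `v 0, …, v (n - 1)` of the vertices. -/
def encodeOrdering {n : ℕ} (v : Equiv.Perm (Fin n)) : List ℕ :=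
  List.ofFn (fun i : Fin n => (v i : ℕ))

/-- The code of a call: `0` for no call, `v + 1` for a call to `v`. -/
def encodeCall {n : ℕ} : Option (Fin n) → ℕ
  | none => 0
  | some v => (v : ℕ) + 1

/-- The memory holds an optimal solution of `(G, s)`: cell `0` contains the optimal broadcast time
`r`, and the next `r * n` cells contain the table (one row of length `n` per round) of the calls of
a broadcast scheme with `r` rounds. -/
def HoldsOptimalScheme {n : ℕ} (G : SimpleGraph (Fin n)) (s : Fin n) (mem : ℕ → ℕ) : Prop :=
  mem 0 = broadcastTime G s ∧
    ∃ c : Calls (Fin n), IsScheme G s (broadcastTime G s) c ∧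
      ∀ t < broadcastTime G s, ∀ u : Fin n, mem (1 + t * n + u) = encodeCall (c t u)

/-- On the given input, `p` halts after at most `T` steps with an optimal solution of `(G, s)` in
memory. -/
def SolvesWithin (p : Prog) (input : List ℕ) {n : ℕ} (G : SimpleGraph (Fin n)) (s : Fin n)
    (T : ℕ) : Prop :=
  ∃ (τ : Config) (t : ℕ), Exec p (initConfig input) τ t ∧ t ≤ T ∧ HoldsOptimalScheme G s τ.mem

end TelephoneBroadcast

/-! A broadcast scheme amounts to a choice, for every vertex `x`, of a caller `y` and a time `t`,
coded as the number `(t * n + y) * n + x < n ^ 3`. The source is coded as calling itself at time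
`0`. Such a choice describes a scheme exactly when each call runs along an edge (`Admissible`) and
any two calls are `Compatible`: a caller is informed before it calls, and it makes one call per
round. This is a binary constraint satisfaction problem. If two vertices are more than `2 * k` apart
in an ordering with bandwidth `k`, their callers differ and neither vertex is the caller of the
other, so their calls are automatically compatible (`compatible_of_far`).

Feasibility is decided by a game on windows of `m = 2 * k + 1` calls. An opponent requests an
arbitrary vertex; the response is a call to it that is compatible with the window, and the oldest
call is dropped. If some window survives `n` requests, requesting the vertices in the bandwidth
order yields a solution (`exists_solution_of_survives`). Conversely, a solution provides answers to
all requests for ever (`IsWindow.shift`). The game does not mention the ordering, whose existence is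
enough; this is why the same program serves both claims, and an ordering in the input is only read
to find `k`.

Optimality comes from self-reduction: the calls are tried from the largest code downwards, and a
call is deleted if a solution remains. What is left is a single solution whose largest code is least
possible (`run_eliminate`). Since the time is the leading digit of a code, its number of rounds is
optimal.

The tables have `n ^ (3 * (2 * k + 1))` windows, and the program is a nest of bounded loops whose
depth does not depend on `k`. A compiler to the machine with a generic time bound
(`Stmt.exec_compile`) therefore gives `f k * n ^ (C * k)` steps; the summand `k ^ 2` in the exponent
is slack. -/

namespace TelephoneBroadcast

/-! ## A language with bounded loops -/

/-- Arithmetic expressions over the variables `ν`. -/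
inductive Expr (ν : Type) : Type
  | var (r : ν)
  | lit (c : ℕ)
  | add (a b : Expr ν)
  | sub (a b : Expr ν)
  | load (a : Expr ν)

/-- Programs over the variables `ν` whose only loops are `for`-loops: `loop i b p` runs `p` with
`i = 0, …, b - 1`, for the value of `b` at the start of the loop. -/
inductive Stmt (ν : Type) : Type
  | skip
  | set (r : ν) (e : Expr ν)
  | store (a b : Expr ν)
  | seq (p q : Stmt ν)
  | ite (e : Expr ν) (p q : Stmt ν)
  | loop (i b : ν) (p : Stmt ν)

/-- Contents of the variables and of the memory. -/
structure State (ν : Type) : Type where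
  reg : ν → ℕ
  mem : ℕ → ℕ

namespace State

variable {ν : Type} [DecidableEq ν]

/-- Overwriting one variable. -/
def set (σ : State ν) (r : ν) (x : ℕ) : State ν := ⟨Function.update σ.reg r x, σ.mem⟩

/-- Overwriting one memory cell. -/
def setMem (σ : State ν) (a x : ℕ) : State ν := ⟨σ.reg, Function.update σ.mem a x⟩

@[simp] theorem set_mem (σ : State ν) (r : ν) (x : ℕ) : (σ.set r x).mem = σ.mem := rfl

@[simp] theorem set_reg (σ : State ν) (r r' : ν) (x : ℕ) :
    (σ.set r x).reg r' = if r' = r then x else σ.reg r' := by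
  simp [set, Function.update_apply]

omit [DecidableEq ν] in
@[simp] theorem setMem_reg (σ : State ν) (a x : ℕ) : (σ.setMem a x).reg = σ.reg := rfl

omit [DecidableEq ν] in
@[simp] theorem setMem_mem (σ : State ν) (a a' x : ℕ) :
    (σ.setMem a x).mem a' = if a' = a then x else σ.mem a' := by
  simp [setMem, Function.update_apply]

end State

namespace Expr

variable {ν : Type}

/-- The value of an expression. -/
def eval (σ : State ν) : Expr ν → ℕ
  | var r => σ.reg r
  | lit c => c
  | add a b => a.eval σ + b.eval σ
  | sub a b => a.eval σ - b.eval σ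
  | load a => σ.mem (a.eval σ)

/-- Negation; a value counts as true if it is not `0`. -/
def not (a : Expr ν) : Expr ν := sub (lit 1) a

/-- Conjunction. -/
def and (a b : Expr ν) : Expr ν := not (add (not a) (not b))

/-- Disjunction. -/
def or (a b : Expr ν) : Expr ν := add a b

/-- Equality test. -/
def eq (a b : Expr ν) : Expr ν := not (add (sub a b) (sub b a))

/-- Strict comparison. -/
def lt (a b : Expr ν) : Expr ν := sub b a

/-- Implication. -/
def imp (a b : Expr ν) : Expr ν := or (not a) b

@[simp] theorem eval_var (σ : State ν) (r : ν) : (var r).eval σ = σ.reg r := rfl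
@[simp] theorem eval_lit (σ : State ν) (c : ℕ) : (lit c).eval σ = c := rfl
@[simp] theorem eval_add (σ : State ν) (a b : Expr ν) :
    (add a b).eval σ = a.eval σ + b.eval σ := rfl
@[simp] theorem eval_sub (σ : State ν) (a b : Expr ν) :
    (sub a b).eval σ = a.eval σ - b.eval σ := rfl
@[simp] theorem eval_load (σ : State ν) (a : Expr ν) : (load a).eval σ = σ.mem (a.eval σ) := rfl

/-- The truth value of an expression. -/
def Holds (σ : State ν) (a : Expr ν) : Prop := a.eval σ ≠ 0

@[simp] theorem holds_var (σ : State ν) (r : ν) : (var r).Holds σ ↔ σ.reg r ≠ 0 := Iff.rfl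
@[simp] theorem holds_load (σ : State ν) (a : Expr ν) :
    (load a).Holds σ ↔ σ.mem (a.eval σ) ≠ 0 := Iff.rfl

@[simp] theorem holds_not (σ : State ν) (a : Expr ν) : (not a).Holds σ ↔ ¬ a.Holds σ := by
  simp only [Holds, not, eval_sub, eval_lit]; omega

@[simp] theorem holds_or (σ : State ν) (a b : Expr ν) :
    (or a b).Holds σ ↔ a.Holds σ ∨ b.Holds σ := by
  simp only [Holds, or, eval_add]; omega

@[simp] theorem holds_and (σ : State ν) (a b : Expr ν) :
    (and a b).Holds σ ↔ a.Holds σ ∧ b.Holds σ := by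
  simp only [and, holds_not]
  have := holds_or σ (not a) (not b)
  simp only [or, holds_not] at this
  rw [this]; tauto

@[simp] theorem holds_imp (σ : State ν) (a b : Expr ν) :
    (imp a b).Holds σ ↔ (a.Holds σ → b.Holds σ) := by
  simp only [imp, holds_or, holds_not]; tauto

@[simp] theorem holds_eq (σ : State ν) (a b : Expr ν) :
    (eq a b).Holds σ ↔ a.eval σ = b.eval σ := by
  simp only [eq, holds_not]; simp only [Holds, eval_sub, eval_add]; omega

@[simp] theorem holds_lt (σ : State ν) (a b : Expr ν) :
    (lt a b).Holds σ ↔ a.eval σ < b.eval σ := by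
  simp only [lt, Holds, eval_sub]; omega

end Expr

namespace Stmt

variable {ν : Type} [DecidableEq ν]

open Classical in
/-- The state after running a program. -/
noncomputable def run : Stmt ν → State ν → State ν
  | skip, σ => σ
  | set r e, σ => σ.set r (e.eval σ)
  | store a b, σ => σ.setMem (a.eval σ) (b.eval σ)
  | seq p q, σ => q.run (p.run σ)
  | ite e p q, σ => if e.Holds σ then p.run σ else q.run σ
  | loop i b p, σ => Nat.rec σ (fun j τ => p.run (τ.set i j)) (σ.reg b)

/-- Does the program write to the variable `r`? -/
def writes (r : ν) : Stmt ν → Bool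
  | skip => false
  | set r' _ => decide (r = r')
  | store _ _ => false
  | seq p q => p.writes r || q.writes r
  | ite _ p q => p.writes r || q.writes r
  | loop i _ p => decide (r = i) || p.writes r

/-- Does the program write to the memory? -/
def stores : Stmt ν → Bool
  | skip => false
  | set _ _ => false
  | store _ _ => true
  | seq p q => p.stores || q.stores
  | ite _ p q => p.stores || q.stores
  | loop _ _ p => p.stores

@[simp] theorem run_skip (σ : State ν) : (skip : Stmt ν).run σ = σ := by simp [run]
@[simp] theorem run_set (σ : State ν) (r : ν) (e : Expr ν) :
    (set r e).run σ = σ.set r (e.eval σ) := by simp [run]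
@[simp] theorem run_store (σ : State ν) (a b : Expr ν) :
    (store a b).run σ = σ.setMem (a.eval σ) (b.eval σ) := by simp [run]
@[simp] theorem run_seq (σ : State ν) (p q : Stmt ν) : (seq p q).run σ = q.run (p.run σ) := by
  simp [run]
open Classical in
theorem run_ite (σ : State ν) (e : Expr ν) (p q : Stmt ν) :
    (ite e p q).run σ = if e.Holds σ then p.run σ else q.run σ := by simp [run]
theorem run_loop (σ : State ν) (i b : ν) (p : Stmt ν) :
    (loop i b p).run σ = Nat.rec σ (fun j τ => p.run (τ.set i j)) (σ.reg b) := by simp [run]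

/-- Frame rule. `writes` is a computable Boolean, so for concrete programs and variables the
hypothesis is discharged by `rfl`. -/
theorem run_reg_of_writes {p : Stmt ν} {r : ν} (h : p.writes r = false) (σ : State ν) :
    (p.run σ).reg r = σ.reg r := by
  induction p generalizing σ with
  | skip => simp
  | set r' e => simp only [writes, decide_eq_false_iff_not] at h; simp [h]
  | store => simp
  | seq p q ihp ihq =>
    simp only [writes, Bool.or_eq_false_iff] at h
    rw [run_seq, ihq h.2, ihp h.1]
  | ite e p q ihp ihq =>
    simp only [writes, Bool.or_eq_false_iff] at h
    rw [run_ite]; split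
    · exact ihp h.1 _
    · exact ihq h.2 _
  | loop i b p ih =>
    simp only [writes, Bool.or_eq_false_iff, decide_eq_false_iff_not] at h
    rw [run_loop]
    induction σ.reg b with
    | zero => rfl
    | succ j ihj => simpa [ih h.2, h.1] using ihj

theorem run_mem_of_stores {p : Stmt ν} (h : p.stores = false) (σ : State ν) :
    (p.run σ).mem = σ.mem := by
  induction p generalizing σ with
  | skip => simp
  | set r' e => simp
  | store => simp [stores] at h
  | seq p q ihp ihq =>
    simp only [stores, Bool.or_eq_false_iff] at h
    rw [run_seq, ihq h.2, ihp h.1]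
  | ite e p q ihp ihq =>
    simp only [stores, Bool.or_eq_false_iff] at h
    rw [run_ite]; split
    · exact ihp h.1 _
    · exact ihq h.2 _
  | loop i b p ih =>
    simp only [stores] at h
    rw [run_loop]
    induction σ.reg b with
    | zero => rfl
    | succ j ihj => simpa [ih h] using ihj

/-- The invariant rule for loops. Variables that the body does not write keep their values. -/
theorem run_loop_induction {σ : State ν} {i b : ν} {p : Stmt ν} (I : ℕ → State ν → Prop)
    (h0 : I 0 σ)
    (hs : ∀ j < σ.reg b, ∀ τ, (∀ r, (loop i b p).writes r = false → τ.reg r = σ.reg r) →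
      (p.stores = false → τ.mem = σ.mem) → I j τ → I (j + 1) (p.run (τ.set i j))) :
    I (σ.reg b) ((loop i b p).run σ) := by
  rw [run_loop]
  -- The frame facts are proved in the same induction as `I`, so that each step may use them.
  suffices H : ∀ j ≤ σ.reg b,
      (∀ r, (loop i b p).writes r = false →
        State.reg (Nat.rec (motive := fun _ => State ν) σ (fun j τ => p.run (τ.set i j)) j) r
          = σ.reg r) ∧
      (p.stores = false →
        State.mem (Nat.rec (motive := fun _ => State ν) σ (fun j τ => p.run (τ.set i j)) j)
          = σ.mem) ∧
      I j (Nat.rec (motive := fun _ => State ν) σ (fun j τ => p.run (τ.set i j)) j) from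
    (H _ le_rfl).2.2
  intro j hj
  induction j with
  | zero => exact ⟨fun _ _ => rfl, fun _ => rfl, h0⟩
  | succ j ih =>
    obtain ⟨h1, h2, h3⟩ := ih (by omega)
    refine ⟨fun r hr => ?_, fun hp => ?_, hs j (by omega) _ h1 h2 h3⟩
    · rw [← h1 r hr]
      simp only [writes, Bool.or_eq_false_iff, decide_eq_false_iff_not] at hr
      simp [run_reg_of_writes hr.2, hr.1]
    · rw [← h2 hp]
      simp [run_mem_of_stores hp]

/-- All loop bounds are among the variables `K`, and these are not written. -/
def BoundedBy (K : ν → Bool) : Stmt ν → Bool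
  | skip => true
  | set r _ => !K r
  | store _ _ => true
  | seq p q => p.BoundedBy K && q.BoundedBy K
  | ite _ p q => p.BoundedBy K && q.BoundedBy K
  | loop i b p => !K i && K b && p.BoundedBy K

/-- Loop bounds keep their initial values, so a single bound `B` on the variables in `K` at the
start controls every loop of the run. -/
theorem BoundedBy.writes {K : ν → Bool} {p : Stmt ν} (h : p.BoundedBy K = true) {r : ν}
    (hr : K r = true) : p.writes r = false := by
  induction p with
  | skip => rfl
  | set r' e =>
    simp only [BoundedBy, Bool.not_eq_true'] at h
    simp only [Stmt.writes, decide_eq_false_iff_not]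
    rintro rfl; simp [hr] at h
  | store => rfl
  | seq p q ihp ihq =>
    simp only [BoundedBy, Bool.and_eq_true] at h
    simp [Stmt.writes, ihp h.1, ihq h.2]
  | ite e p q ihp ihq =>
    simp only [BoundedBy, Bool.and_eq_true] at h
    simp [Stmt.writes, ihp h.1, ihq h.2]
  | loop i b p ih =>
    simp only [BoundedBy, Bool.and_eq_true, Bool.not_eq_true'] at h
    simp only [Stmt.writes, ih h.2, Bool.or_false, decide_eq_false_iff_not]
    rintro rfl; simp [hr] at h

end Stmt

/-! ## Compilation -/

namespace Expr

variable {ν : Type}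

/-- The number of steps of a compiled expression. -/
def cost : Expr ν → ℕ
  | var _ => 2
  | lit _ => 1
  | add a b => a.cost + b.cost + 1
  | sub a b => a.cost + b.cost + 1
  | load a => a.cost + 1

/-- The compiled expression writes its value to register `2 * d + 1` and uses no odd registers
below. -/
def compile (ι : ν → ℕ) : Expr ν → ℕ → Prog
  | var r, d => .seq (.const (2 * d + 1) 0) (.add (2 * d + 1) (2 * d + 1) (2 * ι r))
  | lit c, d => .const (2 * d + 1) c
  | add a b, d => .seq (a.compile ι d)
      (.seq (b.compile ι (d + 1)) (.add (2 * d + 1) (2 * d + 1) (2 * (d + 1) + 1)))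
  | sub a b, d => .seq (a.compile ι d)
      (.seq (b.compile ι (d + 1)) (.sub (2 * d + 1) (2 * d + 1) (2 * (d + 1) + 1)))
  | load a, d => .seq (a.compile ι d) (.load (2 * d + 1) (2 * d + 1))

end Expr

/-- The even registers of a configuration hold the variables of a state. -/
structure Represents {ν : Type} (ι : ν → ℕ) (σ : State ν) (c : Config) : Prop where
  reg : ∀ r, c.reg (2 * ι r) = σ.reg r
  mem : c.mem = σ.mem

namespace Represents

variable {ν : Type} {ι : ν → ℕ} {σ : State ν} {c : Config}

theorem setReg_odd (h : Represents ι σ c) (d x : ℕ) :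
    Represents ι σ (c.setReg (2 * d + 1) x) where
  reg r := by
    rw [← h.reg r]
    exact Function.update_of_ne (by omega) _ _
  mem := h.mem

theorem setReg_even [DecidableEq ν] (hι : Function.Injective ι) (h : Represents ι σ c) (r : ν)
    (x : ℕ) : Represents ι (σ.set r x) (c.setReg (2 * ι r) x) where
  reg r' := by
    by_cases hr : r' = r
    · subst hr; simp [Config.setReg]
    · have : ι r' ≠ ι r := fun h => hr (hι h)
      rw [State.set_reg, if_neg hr, ← h.reg r']
      exact Function.update_of_ne (by omega) _ _
  mem := h.mem

theorem setMem (h : Represents ι σ c) (a x : ℕ) :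
    Represents ι (σ.setMem a x) (c.setMem a x) where
  reg := h.reg
  mem := by simp [Config.setMem, State.setMem, h.mem]

end Represents

/-- Agreement on the odd registers below `2 * d + 1`. -/
def AgreesBelow (d : ℕ) (c c' : Config) : Prop := ∀ j < d, c'.reg (2 * j + 1) = c.reg (2 * j + 1)

namespace AgreesBelow

variable {d d' : ℕ} {c c' c'' : Config}

theorem refl (d : ℕ) (c : Config) : AgreesBelow d c c := fun _ _ => rfl

theorem trans (h : AgreesBelow d c c') (h' : AgreesBelow d c' c'') : AgreesBelow d c c'' :=
  fun j hj => (h' j hj).trans (h j hj)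

theorem mono (h : AgreesBelow d c c') (hd : d' ≤ d) : AgreesBelow d' c c' :=
  fun j hj => h j (by omega)

theorem setReg_odd (h : AgreesBelow d c c') (hd : d ≤ d') (x : ℕ) :
    AgreesBelow d c (c'.setReg (2 * d' + 1) x) := fun j hj => by
  rw [← h j hj]
  exact Function.update_of_ne (by omega) _ _

theorem setReg_even (h : AgreesBelow d c c') (r x : ℕ) :
    AgreesBelow d c (c'.setReg (2 * r) x) := fun j hj => by
  rw [← h j hj]
  exact Function.update_of_ne (by omega) _ _

theorem setMem (h : AgreesBelow d c c') (a x : ℕ) :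
    AgreesBelow d c (c'.setMem a x) := h

end AgreesBelow

/-- The odd registers serve as an evaluation stack. `AgreesBelow` is what makes binary operations
work: the left operand in slot `d` survives the evaluation of the right operand in slot `d + 1`. -/
theorem Expr.exec_compile {ν : Type} {ι : ν → ℕ} {σ : State ν} (e : Expr ν) (d : ℕ) {c : Config}
    (h : Represents ι σ c) :
    ∃ c', Exec (e.compile ι d) c c' e.cost ∧ Represents ι σ c' ∧ AgreesBelow d c c' ∧
      c'.reg (2 * d + 1) = e.eval σ := by
  induction e generalizing d c with
  | var r =>
    refine ⟨_, .seq (.const _ _ _) (.add _ _ _ _), (h.setReg_odd _ _).setReg_odd _ _,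
      ((AgreesBelow.refl d c).setReg_odd le_rfl _).setReg_odd le_rfl _, ?_⟩
    have := (h.setReg_odd d 0).reg r
    simp only [Config.setReg, Function.update_self] at this ⊢
    simp [this]
  | lit x =>
    exact ⟨_, .const _ _ _, h.setReg_odd _ _, (AgreesBelow.refl d c).setReg_odd le_rfl _,
      by simp [Config.setReg]⟩
  | add a b iha ihb =>
    obtain ⟨c₁, e₁, r₁, g₁, v₁⟩ := iha d h
    obtain ⟨c₂, e₂, r₂, g₂, v₂⟩ := ihb (d + 1) r₁
    have ex := Exec.seq e₁ (Exec.seq e₂ (Exec.add c₂ (2 * d + 1) (2 * d + 1) (2 * (d + 1) + 1)))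
    exact ⟨_, ex,
      r₂.setReg_odd d _, (g₁.trans (g₂.mono (by omega))).setReg_odd le_rfl _,
      by simp [Config.setReg, v₂, g₂ d (by omega), v₁]⟩
  | sub a b iha ihb =>
    obtain ⟨c₁, e₁, r₁, g₁, v₁⟩ := iha d h
    obtain ⟨c₂, e₂, r₂, g₂, v₂⟩ := ihb (d + 1) r₁
    have ex := Exec.seq e₁ (Exec.seq e₂ (Exec.sub c₂ (2 * d + 1) (2 * d + 1) (2 * (d + 1) + 1)))
    exact ⟨_, ex,
      r₂.setReg_odd d _, (g₁.trans (g₂.mono (by omega))).setReg_odd le_rfl _,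
      by simp [Config.setReg, v₂, g₂ d (by omega), v₁]⟩
  | load a iha =>
    obtain ⟨c₁, e₁, r₁, g₁, v₁⟩ := iha d h
    exact ⟨_, .seq e₁ (.load _ _ _), r₁.setReg_odd d _, g₁.setReg_odd le_rfl _,
      by simp [Config.setReg, v₁, r₁.mem]⟩

namespace Stmt

variable {ν : Type}

/-- The compiled program keeps variable `r` in register `2 * ι r`, and uses the odd registers from
`2 * d + 1` on for intermediate results. -/
def compile (ι : ν → ℕ) : Stmt ν → ℕ → Prog
  | skip, d => .const (2 * d + 1) 0
  | set r e, d => .seq (e.compile ι d)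
      (.seq (.const (2 * (d + 1) + 1) 0) (.add (2 * ι r) (2 * d + 1) (2 * (d + 1) + 1)))
  | store a b, d => .seq (a.compile ι d)
      (.seq (b.compile ι (d + 1)) (.store (2 * d + 1) (2 * (d + 1) + 1)))
  | seq p q, d => .seq (p.compile ι d) (q.compile ι d)
  | ite e p q, d => .seq (e.compile ι d) (.ite (2 * d + 1) (p.compile ι d) (q.compile ι d))
  | loop i b p, d => .seq ((Expr.var b).compile ι d) (.seq (.const (2 * (d + 1) + 1) 0)
      (.loop (2 * d + 1)
        (.seq (.const (2 * (d + 2) + 1) 0)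
        (.seq (.add (2 * ι i) (2 * (d + 1) + 1) (2 * (d + 2) + 1))
        (.seq (p.compile ι (d + 2))
        (.seq (.const (2 * (d + 2) + 1) 1)
        (.seq (.add (2 * (d + 1) + 1) (2 * (d + 1) + 1) (2 * (d + 2) + 1))
          (.sub (2 * d + 1) (2 * d + 1) (2 * (d + 2) + 1)))))))))

/-- A measure of the length of a program. -/
def size : Stmt ν → ℕ
  | skip => 1
  | set _ e => e.cost + 2
  | store a b => a.cost + b.cost + 1
  | seq p q => p.size + q.size
  | ite e p q => e.cost + p.size + q.size + 1
  | loop _ _ p => p.size + 6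

/-- The nesting depth of the loops. -/
def depth : Stmt ν → ℕ
  | skip => 0
  | set _ _ => 0
  | store _ _ => 0
  | seq p q => max p.depth q.depth
  | ite _ p q => max p.depth q.depth
  | loop _ _ p => p.depth + 1

/-- Each level of loops multiplies the time by at most `B + 1`. A loop occupies slot `d` with the
number of remaining iterations and slot `d + 1` with the current index; slot `d + 2` only holds the
constants `0` and `1` between runs of the body, so the body may use it freely. -/
theorem exec_compile [DecidableEq ν] {ι : ν → ℕ} (hι : Function.Injective ι) {K : ν → Bool}
    {B : ℕ} (p : Stmt ν) (hp : p.BoundedBy K = true) (d : ℕ) {σ : State ν} {c : Config}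
    (hB : ∀ r, K r = true → σ.reg r ≤ B) (h : Represents ι σ c) :
    ∃ c' t, Exec (p.compile ι d) c c' t ∧ t ≤ p.size * (B + 1) ^ p.depth ∧
      Represents ι (p.run σ) c' ∧ AgreesBelow d c c' := by
  induction p generalizing d σ c with
  | skip =>
    exact ⟨_, _, .const _ _ _, by simp [size, depth], by simpa using h.setReg_odd _ _,
      (AgreesBelow.refl d c).setReg_odd le_rfl _⟩
  | set r e =>
    obtain ⟨c₁, e₁, r₁, g₁, v₁⟩ := e.exec_compile d h
    refine ⟨_, _, .seq e₁ (.seq (.const _ _ _) (.add _ _ _ _)), by simp [size, depth], ?_,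
      (g₁.setReg_odd (by omega) _).setReg_even _ _⟩
    have := (r₁.setReg_odd (d + 1) 0).setReg_even hι r (e.eval σ)
    simpa [Config.setReg, v₁] using this
  | store a b =>
    obtain ⟨c₁, e₁, r₁, g₁, v₁⟩ := a.exec_compile d h
    obtain ⟨c₂, e₂, r₂, g₂, v₂⟩ := b.exec_compile (d + 1) r₁
    refine ⟨_, _, .seq e₁ (.seq e₂ (.store _ _ _)), by simp [size, depth, add_assoc], ?_,
      (g₁.trans (g₂.mono (by omega))).setMem _ _⟩
    rw [v₂, g₂ d (by omega), v₁, run_store]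
    exact r₂.setMem _ _
  | seq p q ihp ihq =>
    simp only [BoundedBy, Bool.and_eq_true] at hp
    obtain ⟨c₁, t₁, e₁, b₁, r₁, g₁⟩ := ihp hp.1 d hB h
    obtain ⟨c₂, t₂, e₂, b₂, r₂, g₂⟩ := ihq hp.2 d
      (fun r hr => by rw [run_reg_of_writes (BoundedBy.writes hp.1 hr)]; exact hB r hr) r₁
    refine ⟨_, _, .seq e₁ e₂, ?_, by simpa using r₂, g₁.trans g₂⟩
    have h₁ : (B + 1) ^ p.depth ≤ (B + 1) ^ (max p.depth q.depth) :=
      Nat.pow_le_pow_right (by omega) (le_max_left _ _)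
    have h₂ : (B + 1) ^ q.depth ≤ (B + 1) ^ (max p.depth q.depth) :=
      Nat.pow_le_pow_right (by omega) (le_max_right _ _)
    calc t₁ + t₂ ≤ p.size * (B + 1) ^ (max p.depth q.depth)
          + q.size * (B + 1) ^ (max p.depth q.depth) :=
          add_le_add (b₁.trans (Nat.mul_le_mul_left _ h₁)) (b₂.trans (Nat.mul_le_mul_left _ h₂))
      _ = _ := by simp only [size, depth]; ring
  | ite e p q ihp ihq =>
    simp only [BoundedBy, Bool.and_eq_true] at hp
    obtain ⟨c₁, e₁, r₁, g₁, v₁⟩ := e.exec_compile d h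
    have h₁ : (B + 1) ^ p.depth ≤ (B + 1) ^ (max p.depth q.depth) :=
      Nat.pow_le_pow_right (by omega) (le_max_left _ _)
    have h₂ : (B + 1) ^ q.depth ≤ (B + 1) ^ (max p.depth q.depth) :=
      Nat.pow_le_pow_right (by omega) (le_max_right _ _)
    have h₀ : 1 ≤ (B + 1) ^ (max p.depth q.depth) := Nat.one_le_pow _ _ (by omega)
    have h₃ := Nat.mul_le_mul_left (e.cost + 1) h₀
    have h₄ := Nat.mul_le_mul_left p.size h₁
    have h₅ := Nat.mul_le_mul_left q.size h₂
    have h₆ : (ite e p q).size * (B + 1) ^ (ite e p q).depth =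
        (e.cost + 1) * (B + 1) ^ (max p.depth q.depth) + p.size * (B + 1) ^ (max p.depth q.depth)
          + q.size * (B + 1) ^ (max p.depth q.depth) := by simp only [size, depth]; ring
    by_cases he : e.Holds σ
    · obtain ⟨c₂, t₂, e₂, b₂, r₂, g₂⟩ := ihp hp.1 d hB r₁
      refine ⟨_, _, .seq e₁ (.ite_true (by rw [v₁]; exact he) e₂), ?_, by simpa [run_ite, he] using r₂,
        g₁.trans g₂⟩
      rw [h₆]; omega
    · obtain ⟨c₂, t₂, e₂, b₂, r₂, g₂⟩ := ihq hp.2 d hB r₁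
      refine ⟨_, _, .seq e₁ (.ite_false (by rw [v₁]; exact not_not.mp he) e₂), ?_,
        by simpa [run_ite, he] using r₂, g₁.trans g₂⟩
      rw [h₆]; omega
  | loop i b p ih =>
    simp only [BoundedBy, Bool.and_eq_true, Bool.not_eq_true'] at hp
    obtain ⟨c₁, e₁, r₁, g₁, v₁⟩ := (Expr.var b).exec_compile d h
    -- `k` iterations remain and the next index is `j`. Both are general because the machine peels
    -- off the first iteration. The summand `6` is the cost of the test and of the five bookkeeping
    -- instructions.
    have key : ∀ k j : ℕ, ∀ (τ : State ν) (c : Config), Represents ι τ c →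
        (∀ r, K r = true → τ.reg r ≤ B) → c.reg (2 * d + 1) = k → c.reg (2 * (d + 1) + 1) = j →
        ∃ c' t, Exec (.loop (2 * d + 1)
        (.seq (.const (2 * (d + 2) + 1) 0)
        (.seq (.add (2 * ι i) (2 * (d + 1) + 1) (2 * (d + 2) + 1))
        (.seq (p.compile ι (d + 2))
        (.seq (.const (2 * (d + 2) + 1) 1)
        (.seq (.add (2 * (d + 1) + 1) (2 * (d + 1) + 1) (2 * (d + 2) + 1))
          (.sub (2 * d + 1) (2 * d + 1) (2 * (d + 2) + 1)))))))) c c' t ∧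
          t ≤ k * (p.size * (B + 1) ^ p.depth + 6) + 1 ∧
          Represents ι (Nat.rec τ (fun l υ => p.run (υ.set i (j + l))) k) c' ∧
          AgreesBelow d c c' := by
      intro k
      induction k with
      | zero =>
        intro j τ c hr _ hk _
        exact ⟨c, 1, .loop_done hk, by simp, hr, AgreesBelow.refl _ _⟩
      | succ k ihk =>
        intro j τ c hr hτ hk hj
        have hr₁ : Represents ι (τ.set i j)
            ((c.setReg (2 * (d + 2) + 1) 0).setReg (2 * ι i) j) :=
          (hr.setReg_odd _ _).setReg_even hι _ _
        have hτ₁ : ∀ r, K r = true → (τ.set i j).reg r ≤ B := fun r hr => by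
          rw [State.set_reg, if_neg (by rintro rfl; simp [hr] at hp)]
          exact hτ r hr
        obtain ⟨c₂, t₂, e₂, b₂, r₂, g₂⟩ := ih hp.2 (d + 2) hτ₁ hr₁
        have a₁ : c₂.reg (2 * (d + 1) + 1) = j := by
          rw [g₂ (d + 1) (by omega)]
          have : 2 * (d + 1) + 1 ≠ 2 * ι i := by omega
          simp [Config.setReg, Function.update_of_ne this, hj]
        have a₂ : c₂.reg (2 * d + 1) = k + 1 := by
          rw [g₂ d (by omega)]
          have : 2 * d + 1 ≠ 2 * ι i := by omega
          simp [Config.setReg, Function.update_of_ne this, hk]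
        have hr₃ : Represents ι (p.run (τ.set i j))
            (((c₂.setReg (2 * (d + 2) + 1) 1).setReg (2 * (d + 1) + 1) (j + 1)).setReg
              (2 * d + 1) k) := ((r₂.setReg_odd _ _).setReg_odd _ _).setReg_odd _ _
        obtain ⟨c₄, t₄, e₄, b₄, r₄, g₄⟩ := ihk (j + 1) _ _ hr₃
          (fun r hr => by rw [run_reg_of_writes (BoundedBy.writes hp.2 hr)]; exact hτ₁ r hr)
          (by simp [Config.setReg]) (by simp [Config.setReg])
        have ex : Exec (.seq (.const (2 * (d + 2) + 1) 0)
            (.seq (.add (2 * ι i) (2 * (d + 1) + 1) (2 * (d + 2) + 1))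
            (.seq (p.compile ι (d + 2))
            (.seq (.const (2 * (d + 2) + 1) 1)
            (.seq (.add (2 * (d + 1) + 1) (2 * (d + 1) + 1) (2 * (d + 2) + 1))
              (.sub (2 * d + 1) (2 * d + 1) (2 * (d + 2) + 1))))))) c
            (((c₂.setReg (2 * (d + 2) + 1) 1).setReg (2 * (d + 1) + 1) (j + 1)).setReg
              (2 * d + 1) k) (1 + (1 + (t₂ + (1 + (1 + 1))))) := by
          refine .seq (.const _ _ _) (.seq (.add _ _ _ _) (.seq (τ := c₂) ?_
            (.seq (.const _ _ _) (.seq (τ := (c₂.setReg (2 * (d + 2) + 1) 1).setReg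
              (2 * (d + 1) + 1) (j + 1)) ?_ ?_))))
          · simpa [Config.setReg, hj] using e₂
          · have := Exec.add (c₂.setReg (2 * (d + 2) + 1) 1) (2 * (d + 1) + 1) (2 * (d + 1) + 1)
              (2 * (d + 2) + 1)
            simpa [Config.setReg, a₁] using this
          · have := Exec.sub ((c₂.setReg (2 * (d + 2) + 1) 1).setReg (2 * (d + 1) + 1) (j + 1))
              (2 * d + 1) (2 * d + 1) (2 * (d + 2) + 1)
            simpa [Config.setReg, a₂] using this
        refine ⟨c₄, _, .loop_step (by omega) ex e₄, ?_, ?_, ?_⟩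
        · have : (k + 1) * (p.size * (B + 1) ^ p.depth + 6) =
            k * (p.size * (B + 1) ^ p.depth + 6) + (p.size * (B + 1) ^ p.depth + 6) := by ring
          omega
        -- The recursor peels off the last iteration and the machine the first one; the two are
        -- matched by shifting the index by one.
        · have : ∀ k : ℕ, (Nat.rec (motive := fun _ => State ν) (p.run (τ.set i j))
              (fun l υ => p.run (υ.set i (j + 1 + l))) k) =
              Nat.rec (motive := fun _ => State ν) τ
                (fun l υ => p.run (υ.set i (j + l))) (k + 1) := by
            intro k
            induction k with
            | zero => simp
            | succ k ih => simp only [ih]; rw [show j + 1 + k = j + (k + 1) by ring]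
          rw [this] at r₄
          exact r₄
        · refine AgreesBelow.trans ?_ g₄
          refine (((AgreesBelow.trans ?_ (g₂.mono (by omega))).setReg_odd (by omega) _).setReg_odd
            (by omega) _).setReg_odd le_rfl _
          exact ((AgreesBelow.refl _ _).setReg_odd (by omega) _).setReg_even _ _
    have r₁' := r₁.setReg_odd (d + 1) 0
    obtain ⟨c₂, t₂, e₂, b₂, r₂, g₂⟩ := key (σ.reg b) 0 σ _ r₁' hB
      (by simpa [Config.setReg] using v₁) (by simp [Config.setReg])
    refine ⟨c₂, _, .seq e₁ (.seq (.const _ _ _) e₂), ?_, ?_, ?_⟩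
    · have h₀ : 1 ≤ (B + 1) ^ p.depth := Nat.one_le_pow _ _ (by omega)
      have hb : σ.reg b ≤ B := hB b hp.1.2
      have h₁ := Nat.mul_le_mul_right (p.size * (B + 1) ^ p.depth + 6) hb
      have h₂ : B * (p.size * (B + 1) ^ p.depth + 6) + 6 ≤
          (p.size + 6) * (B + 1) ^ (p.depth + 1) := by
        calc B * (p.size * (B + 1) ^ p.depth + 6) + 6
            ≤ B * (p.size * (B + 1) ^ p.depth + 6 * (B + 1) ^ p.depth)
              + (p.size * (B + 1) ^ p.depth + 6 * (B + 1) ^ p.depth) := by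
              gcongr <;> omega
          _ = _ := by ring
      simp only [Expr.cost, size, depth]
      omega
    · rw [run_loop]; simpa using r₂
    · exact (g₁.setReg_odd (by omega) _).trans g₂

end Stmt

/-! ## Broadcast schemes as a constraint satisfaction problem

The number `(t * n + y) * n + x` stands for the statement that vertex `x` is called by vertex `y`
and is informed after `t` rounds. -/

/-- The vertex that is called. -/
def vertexOf (n e : ℕ) : ℕ := e % n

/-- The vertex that makes the call. -/
def callerOf (n e : ℕ) : ℕ := e / n % n

/-- The time of the call. -/
def timeOf (n e : ℕ) : ℕ := e / n / n

/-- Two calls can belong to the same broadcast scheme. -/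
def Compatible (n e f : ℕ) : Prop :=
  e = f ∨ (vertexOf n e ≠ vertexOf n f ∧
    (callerOf n e = vertexOf n f → timeOf n f < timeOf n e) ∧
    (callerOf n f = vertexOf n e → timeOf n e < timeOf n f) ∧
    (callerOf n e = callerOf n f → timeOf n e ≠ timeOf n f))

theorem Compatible.symm {n e f : ℕ} (h : Compatible n e f) : Compatible n f e := by
  rcases h with rfl | ⟨h1, h2, h3, h4⟩
  · exact .inl rfl
  · exact .inr ⟨h1.symm, h3, h2, fun h => (h4 h.symm).symm⟩

/-- A choice of pairwise compatible calls from `A`, one for each vertex. -/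
structure IsSolution (n : ℕ) (A : ℕ → Prop) (a : ℕ → ℕ) : Prop where
  lt : ∀ x < n, a x < n * n * n
  vertex : ∀ x < n, vertexOf n (a x) = x
  mem : ∀ x < n, A (a x)
  compatible : ∀ x < n, ∀ y < n, Compatible n (a x) (a y)

theorem IsSolution.mono {n : ℕ} {A A' : ℕ → Prop} {a : ℕ → ℕ} (h : IsSolution n A a)
    (hA : ∀ x < n, A' (a x)) : IsSolution n A' a := { h with mem := hA }

/-! ### Windows

A window of `m` calls is represented by the number with these `m` digits to base `n * n * n`; the last
digit is the most recent call. -/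

/-- The last call of the window `p` is in `A` and is compatible with the others. -/
def Coherent (n m : ℕ) (A : ℕ → Prop) (p : ℕ) : Prop :=
  A (p % (n * n * n)) ∧
    ∀ j < m, Compatible n (p % (n * n * n)) (p / (n * n * n) ^ j % (n * n * n))

/-- Starting from the window `p`, one can respond to `L` successive requests for vertices. -/
def Survives (n m : ℕ) (A : ℕ → Prop) : ℕ → ℕ → Prop
  | 0, p => Coherent n m A p
  | L + 1, p => Coherent n m A p ∧ ∀ x < n, ∃ z < n * n,
      Survives n m A L (p * (n * n * n) % (n * n * n) ^ m + (z * n + x))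

theorem Survives.coherent {n m : ℕ} {A : ℕ → Prop} {L p : ℕ} (h : Survives n m A L p) :
    Coherent n m A p := by
  cases L with
  | zero => exact h
  | succ L => exact h.1

theorem mod_pow_div_mod (a N : ℕ) {i m : ℕ} (h : i < m) :
    a % N ^ m / N ^ i % N = a / N ^ i % N := by
  obtain ⟨c, rfl⟩ := Nat.exists_eq_add_of_lt h
  rw [show N ^ (i + c + 1) = N ^ i * (N * N ^ c) by ring, Nat.mod_mul_right_div_self,
    Nat.mod_mul_right_mod]

/-- Together with `shift_mod` and `shift_div`: the number `p * N % N ^ m + e` arises from the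
`m`-digit number `p` by dropping the oldest digit and appending `e`. -/
theorem shift_lt {N p e m : ℕ} (hm : 0 < m) (he : e < N) : p * N % N ^ m + e < N ^ m := by
  obtain ⟨m, rfl⟩ := Nat.exists_eq_succ_of_ne_zero hm.ne'
  have hN : 0 < N := by omega
  rw [Nat.succ_eq_add_one, pow_succ, Nat.mul_mod_mul_right]
  have h1 : p % N ^ m < N ^ m := Nat.mod_lt _ (pow_pos hN _)
  nlinarith

theorem shift_mod {N p e m : ℕ} (hm : 0 < m) (he : e < N) : (p * N % N ^ m + e) % N = e := by
  obtain ⟨m, rfl⟩ := Nat.exists_eq_succ_of_ne_zero hm.ne'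
  rw [Nat.succ_eq_add_one, pow_succ, Nat.mul_mod_mul_right, Nat.add_comm,
    Nat.add_mul_mod_self_right, Nat.mod_eq_of_lt he]

theorem shift_div {N p e m i : ℕ} (he : e < N) (hi : i + 1 < m) :
    (p * N % N ^ m + e) / N ^ (i + 1) % N = p / N ^ i % N := by
  obtain ⟨m, rfl⟩ := Nat.exists_eq_succ_of_ne_zero (show m ≠ 0 by omega)
  have hN : 0 < N := by omega
  rw [Nat.succ_eq_add_one, pow_succ, Nat.mul_mod_mul_right, pow_succ', ← Nat.div_div_eq_div_mul,
    Nat.add_comm, Nat.add_mul_div_right _ _ hN, Nat.div_eq_of_lt he, zero_add,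
    mod_pow_div_mod _ _ (by omega)]

theorem mul_add_lt {n z x : ℕ} (hz : z < n * n) (hx : x < n) : z * n + x < n * n * n := by
  nlinarith

/-- The opponent requests `π 0, …, π (n - 1)`. Responses fewer than `m` steps apart meet in a window
and are compatible by coherence; the others are compatible by `far`. -/
theorem exists_solution_of_survives {n m : ℕ} {A : ℕ → Prop} (hm : 0 < m) {π : ℕ → ℕ}
    (hlt : ∀ i < n, π i < n) (hsurj : ∀ x < n, ∃ i < n, π i = x)
    (far : ∀ i j, i + m ≤ j → j < n → ∀ e f, A e → A f → vertexOf n e = π i →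
      vertexOf n f = π j → Compatible n f e)
    {p : ℕ} (hp : Survives n m A n p) : ∃ a, IsSolution n A a := by
  set N := n * n * n with hN
  -- After `j` requests the last digits of `p` are the latest responses, newest first. Digits left
  -- over from the initial window are of no interest, hence the condition `d < j`.
  have key : ∀ j ≤ n, ∃ (e : ℕ → ℕ) (p : ℕ), Survives n m A (n - j) p ∧
      (∀ i < j, e i < N ∧ vertexOf n (e i) = π i ∧ A (e i)) ∧
      (∀ d < m, d < j → p / N ^ d % N = e (j - 1 - d)) ∧
      (∀ i i', i < i' → i' < j → Compatible n (e i') (e i)) := by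
    intro j
    induction j with
    | zero => exact fun _ => ⟨fun _ => 0, p, hp, by simp, by simp, by simp⟩
    | succ j ih =>
      intro hj
      obtain ⟨e, p, h1, h2, h3, h4⟩ := ih (by omega)
      rw [show n - j = n - (j + 1) + 1 by omega] at h1
      obtain ⟨z, hz, hs⟩ := h1.2 (π j) (hlt j (by omega))
      have hx := hlt j (by omega)
      have hf : z * n + π j < N := mul_add_lt hz hx
      set f := z * n + π j with hfdef
      have hv : vertexOf n f = π j := by
        simp only [vertexOf, hfdef]
        rw [Nat.add_comm, Nat.add_mul_mod_self_right, Nat.mod_eq_of_lt hx]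
      have hc := hs.coherent
      simp only [Coherent, ← hN, shift_mod hm hf] at hc
      have hdig : ∀ d < m, d < j + 1 →
          (p * N % N ^ m + f) / N ^ d % N = Function.update e j f (j + 1 - 1 - d) := by
        intro d hd hdj
        rcases d with _ | d
        · simp [shift_mod hm hf]
        · rw [shift_div hf hd, h3 d (by omega) (by omega),
            Function.update_of_ne (by omega)]
          congr 1; omega
      refine ⟨Function.update e j f, _, hs, ?_, hdig, ?_⟩
      · intro i hi
        by_cases hij : i = j
        · subst hij; simpa using ⟨hf, hv, hc.1⟩
        · rw [Function.update_of_ne hij]; exact h2 i (by omega)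
      · intro i i' hi hi'
        by_cases hij : i' = j
        · subst hij
          rw [Function.update_self, Function.update_of_ne hi.ne]
          -- Either the older call is still in the window, or the positions are far apart.
          by_cases hd : i' - i < m
          · have := hc.2 (i' - i) hd
            rw [hdig _ hd (by omega), Function.update_of_ne (by omega)] at this
            rwa [show i' + 1 - 1 - (i' - i) = i by omega] at this
          · obtain ⟨-, a1, a2⟩ := h2 i hi
            exact far i i' (by omega) (by omega) _ _ a2 hc.1 a1 hv
        · rw [Function.update_of_ne hij, Function.update_of_ne (by omega)]
          exact h4 i i' hi (by omega)
  obtain ⟨e, -, -, h2, -, h4⟩ := key n le_rfl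
  choose! ρ hρ using hsurj
  refine ⟨fun x => e (ρ x), ⟨fun x hx => (h2 _ (hρ x hx).1).1, fun x hx => ?_,
    fun x hx => (h2 _ (hρ x hx).1).2.2, fun x hx y hy => ?_⟩⟩
  · rw [(h2 _ (hρ x hx).1).2.1, (hρ x hx).2]
  · rcases lt_trichotomy (ρ x) (ρ y) with h | h | h
    · exact (h4 _ _ h (hρ y hy).1).symm
    · simp only [h]; exact .inl rfl
    · exact h4 _ _ h (hρ x hx).1

/-- All calls of the window `p` belong to `a`. -/
def IsWindow (n m : ℕ) (a : ℕ → ℕ) (p : ℕ) : Prop :=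
  ∀ j < m, ∃ x < n, p / (n * n * n) ^ j % (n * n * n) = a x

theorem IsWindow.coherent {n m : ℕ} {A : ℕ → Prop} {a : ℕ → ℕ} (ha : IsSolution n A a)
    (hm : 0 < m) {p : ℕ} (hp : IsWindow n m a p) : Coherent n m A p := by
  obtain ⟨x, hx, h⟩ := hp 0 hm
  simp only [pow_zero, Nat.div_one] at h
  refine ⟨h ▸ ha.mem x hx, fun j hj => ?_⟩
  obtain ⟨y, hy, h'⟩ := hp j hj
  rw [h, h']
  exact ha.compatible x hx y hy

/-- Answering `x` by `a x` stays within the solution, so the windows of a solution form a set closed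
under responses. The quotient `a x / n` is the witness because the last base-`n` digit of `a x` is
`x`. -/
theorem IsWindow.shift {n m : ℕ} {A : ℕ → Prop} {a : ℕ → ℕ} (ha : IsSolution n A a)
    (hm : 0 < m) {p : ℕ} (hp : IsWindow n m a p) {x : ℕ} (hx : x < n) :
    ∃ z < n * n, IsWindow n m a (p * (n * n * n) % (n * n * n) ^ m + (z * n + x)) := by
  have hn : 0 < n := by omega
  have h1 := ha.lt x hx
  have h2 : a x / n * n + x = a x := by
    have := Nat.div_add_mod (a x) n
    rwa [show a x % n = x from ha.vertex x hx, Nat.mul_comm] at this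
  refine ⟨a x / n, Nat.div_lt_of_lt_mul (by rwa [Nat.mul_comm] at h1), ?_⟩
  rw [h2]
  intro j hj
  rcases j with _ | j
  · exact ⟨x, hx, by simp [shift_mod hm h1]⟩
  · rw [shift_div h1 hj]
    exact hp j (by omega)

/-- The window repeats the single call `a 0`; repetitions are harmless because a call is compatible
with itself. -/
theorem exists_isWindow {n : ℕ} (m : ℕ) {A : ℕ → Prop} {a : ℕ → ℕ} (ha : IsSolution n A a)
    (hn : 0 < n) : ∃ p < (n * n * n) ^ m, IsWindow n m a p := by
  induction m with
  | zero => exact ⟨0, by simp, fun j hj => absurd hj (by omega)⟩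
  | succ m ih =>
    obtain ⟨p, hp, h⟩ := ih
    have h1 := ha.lt 0 hn
    have hN : 0 < n * n * n := by positivity
    refine ⟨p * (n * n * n) + a 0, by rw [pow_succ]; nlinarith, fun j hj => ?_⟩
    rcases j with _ | j
    · exact ⟨0, hn, by simp [Nat.add_mod, Nat.mod_eq_of_lt h1]⟩
    · rw [pow_succ', ← Nat.div_div_eq_div_mul, Nat.add_comm, Nat.add_mul_div_right _ _ hN,
        Nat.div_eq_of_lt h1, zero_add]
      exact h j (by omega)

/-! ### Timings -/

/-- An assignment of times and callers to the vertices that describes a broadcast scheme. -/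
structure IsTiming {n : ℕ} (G : SimpleGraph (Fin n)) (s : Fin n) (t : Fin n → ℕ)
    (y : Fin n → Fin n) : Prop where
  source : t s = 0
  adj : ∀ x ≠ s, G.Adj x (y x)
  lt : ∀ x ≠ s, t (y x) < t x
  ne : ∀ x ≠ s, ∀ x' ≠ s, y x = y x' → t x = t x' → x = x'

section Timing

variable {n : ℕ} {G : SimpleGraph (Fin n)} {s : Fin n}

/-- The time of `x` is the first moment at which `x` is informed, and its caller is whoever calls it
in the round before. Condition `ne` holds because a caller makes one call per round. -/
theorem IsScheme.exists_timing {r : ℕ} {c : Calls (Fin n)} (h : IsScheme G s r c) :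
    ∃ t y, IsTiming G s t y ∧ ∀ x, t x ≤ r := by
  classical
  have hex : ∀ x, ∃ i, x ∈ informed s c i := fun x => ⟨r, by rw [h.all_informed]; trivial⟩
  set t : Fin n → ℕ := fun x => Nat.find (hex x) with ht
  have hmem : ∀ x, x ∈ informed s c (t x) := fun x => Nat.find_spec (hex x)
  have hle : ∀ x i, x ∈ informed s c i → t x ≤ i := fun x i hi => Nat.find_min' (hex x) hi
  have htr : ∀ x, t x ≤ r := fun x => hle x r (by rw [h.all_informed]; trivial)
  have hcall : ∀ x, ∃ u, x ≠ s → t x ≠ 0 ∧ u ∈ informed s c (t x - 1) ∧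
      c (t x - 1) u = some x := by
    intro x
    by_cases hx : x = s
    · exact ⟨x, fun h => absurd hx h⟩
    have h0 : t x ≠ 0 := fun h0 => by
      have := hmem x
      rw [h0] at this
      exact hx this
    have h1 := hmem x
    rw [show t x = t x - 1 + 1 by omega] at h1
    rcases h1 with h1 | ⟨u, hu, hc⟩
    · have := hle x _ h1
      omega
    · exact ⟨u, fun _ => ⟨h0, hu, hc⟩⟩
  choose y hy using hcall
  refine ⟨t, y, ⟨?_, fun x hx => ?_, fun x hx => ?_, fun x hx x' hx' hyy htt => ?_⟩, htr⟩
  · exact Nat.le_zero.mp (hle s 0 rfl)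
  · obtain ⟨h0, -, h2⟩ := hy x hx
    exact (h.adj _ (by have := htr x; omega) _ _ h2).symm
  · obtain ⟨h0, h1, -⟩ := hy x hx
    have := hle _ _ h1
    omega
  · have h1 := (hy x hx).2.2
    have h2 := (hy x' hx').2.2
    rw [htt, hyy, h2] at h1
    exact (Option.some.inj h1).symm

open Classical in
/-- The calls of a timing. -/
noncomputable def callsOf (s : Fin n) (t : Fin n → ℕ) (y : Fin n → Fin n) : Calls (Fin n) :=
  fun i u => if h : ∃ x, x ≠ s ∧ y x = u ∧ t x = i + 1 then some h.choose else none

/-- By `ne` at most one vertex qualifies, so the choice in `callsOf` is forced. -/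
theorem IsTiming.callsOf_eq_some {t : Fin n → ℕ} {y : Fin n → Fin n} (h : IsTiming G s t y)
    {i : ℕ} {u x : Fin n} :
    callsOf s t y i u = some x ↔ x ≠ s ∧ y x = u ∧ t x = i + 1 := by
  unfold callsOf
  constructor
  · intro hx
    split at hx
    · rename_i hex
      rw [← Option.some.inj hx]
      exact hex.choose_spec
    · cases hx
  · intro hx
    have hex : ∃ x, x ≠ s ∧ y x = u ∧ t x = i + 1 := ⟨x, hx⟩
    rw [dif_pos hex]
    congr 1
    obtain ⟨h1, h2, h3⟩ := hex.choose_spec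
    exact h.ne _ h1 _ hx.1 (h2.trans hx.2.1.symm) (h3.trans hx.2.2.symm)

theorem IsTiming.mem_informed {t : Fin n → ℕ} {y : Fin n → Fin n} (h : IsTiming G s t y)
    (i : ℕ) (x : Fin n) : x ∈ informed s (callsOf s t y) i ↔ t x ≤ i := by
  have hpos : ∀ x, x ≠ s → 0 < t x := fun x hx => (Nat.zero_le _).trans_lt (h.lt x hx)
  induction i generalizing x with
  | zero =>
    rw [Nat.le_zero]
    constructor
    · rintro rfl; exact h.source
    · intro h0
      by_contra hx
      exact absurd h0 (hpos x hx).ne'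
  | succ i ih =>
    constructor
    · rintro (hx | ⟨u, -, hc⟩)
      · exact ((ih x).mp hx).trans (Nat.le_succ i)
      · exact (h.callsOf_eq_some.mp hc).2.2.le
    · intro hx
      rcases hx.lt_or_eq with hx | hx
      · exact Or.inl ((ih x).mpr (by omega))
      · have hs : x ≠ s := by rintro rfl; rw [h.source] at hx; omega
        refine Or.inr ⟨y x, (ih _).mpr ?_, h.callsOf_eq_some.mpr ⟨hs, rfl, hx⟩⟩
        have := h.lt x hs
        omega

theorem IsTiming.isScheme {t : Fin n → ℕ} {y : Fin n → Fin n} (h : IsTiming G s t y) {r : ℕ}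
    (hr : ∀ x, t x ≤ r) : IsScheme G s r (callsOf s t y) where
  caller_informed i _ u v hc := by
    obtain ⟨h1, h2, h3⟩ := h.callsOf_eq_some.mp hc
    rw [h.mem_informed, ← h2]
    have := h.lt v h1
    omega
  callee_uninformed i _ u v hc := by
    obtain ⟨h1, h2, h3⟩ := h.callsOf_eq_some.mp hc
    rw [h.mem_informed]
    omega
  adj i _ u v hc := by
    obtain ⟨h1, h2, h3⟩ := h.callsOf_eq_some.mp hc
    rw [← h2]
    exact (h.adj v h1).symm
  one_caller i _ u u' v hc hc' := by
    rw [← (h.callsOf_eq_some.mp hc).2.1, (h.callsOf_eq_some.mp hc').2.1]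
  all_informed := Set.eq_univ_of_forall fun x => (h.mem_informed r x).mpr (hr x)

/-- Sort the vertices by distance from `s` and inform one per round, each from a neighbour closer to
`s`. All times are distinct, so `ne` is automatic, and they are below `n`, so they fit into one
base-`n` digit. -/
theorem exists_timing_lt (hG : G.Connected) (s : Fin n) :
    ∃ t y, IsTiming G s t y ∧ ∀ x, t x < n := by
  classical
  set d : Fin n → ℕ := fun x => G.dist s x with hd
  set ρ := Tuple.sort d
  have hmono : Monotone (d ∘ ρ) := Tuple.monotone_sort d
  have hlt : ∀ x x', d x < d x' → ρ.symm x < ρ.symm x' := fun x x' h => by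
    by_contra hc
    have := hmono (not_lt.mp hc)
    simp at this
    omega
  have hn : 0 < n := s.pos
  have hpos : ∀ x, x ≠ s → d s < d x := fun x hx => by
    simp only [hd, SimpleGraph.dist_self]
    exact hG.pos_dist_of_ne hx.symm
  have hs : (ρ.symm s : ℕ) = 0 := by
    by_contra h0
    have h1 : ρ ⟨0, hn⟩ ≠ s := fun h => h0 (by rw [← h]; simp)
    have := hlt _ _ (hpos _ h1)
    rw [Equiv.symm_apply_apply, Fin.lt_def] at this
    simp at this
  have hex : ∀ x, ∃ u, x ≠ s → G.Adj x u ∧ d u < d x := fun x => by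
    by_cases hx : x = s
    · exact ⟨x, fun h => absurd hx h⟩
    obtain ⟨w, hw⟩ := hG.exists_walk_length_eq_dist x s
    cases w with
    | nil => exact absurd rfl hx
    | @cons _ u _ hu q =>
      refine ⟨u, fun _ => ⟨hu, ?_⟩⟩
      have h1 := G.dist_le q
      rw [SimpleGraph.Walk.length_cons] at hw
      simp only [hd]
      rw [G.dist_comm (u := s) (v := u), G.dist_comm (u := s) (v := x)]
      omega
  choose y hy using hex
  refine ⟨fun x => ρ.symm x, y, ⟨hs, fun x hx => (hy x hx).1,
    fun x hx => hlt _ _ (hy x hx).2, fun x _ x' _ _ h => ?_⟩, fun x => (ρ.symm x).2⟩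
  exact ρ.symm.injective (Fin.ext h)

end Timing

/-! ### Solutions versus timings, and locality of the constraints under a bandwidth ordering. -/

section Admissible

variable {n : ℕ} {G : SimpleGraph (Fin n)} {s : Fin n}

/-- The call is along an edge, or represents the source. -/
def Admissible (G : SimpleGraph (Fin n)) (s : Fin n) (e : ℕ) : Prop :=
  (vertexOf n e = s ∧ callerOf n e = s ∧ timeOf n e = 0) ∨
    (vertexOf n e ≠ s ∧ timeOf n e ≠ 0 ∧
      ∃ (hx : vertexOf n e < n) (hy : callerOf n e < n), G.Adj ⟨_, hx⟩ ⟨_, hy⟩)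

theorem vertexOf_mk {t x y : ℕ} (hx : x < n) : vertexOf n ((t * n + y) * n + x) = x := by
  rw [vertexOf, Nat.add_comm, Nat.add_mul_mod_self_right, Nat.mod_eq_of_lt hx]

theorem mk_div {w x : ℕ} (hx : x < n) : (w * n + x) / n = w := by
  rw [Nat.add_comm, Nat.add_mul_div_right _ _ (by omega), Nat.div_eq_of_lt hx, zero_add]

theorem callerOf_mk {t x y : ℕ} (hx : x < n) (hy : y < n) :
    callerOf n ((t * n + y) * n + x) = y := by
  rw [callerOf, mk_div hx, Nat.add_comm, Nat.add_mul_mod_self_right, Nat.mod_eq_of_lt hy]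

theorem timeOf_mk {t x y : ℕ} (hx : x < n) (hy : y < n) :
    timeOf n ((t * n + y) * n + x) = t := by
  rw [timeOf, mk_div hx, mk_div hy]

theorem vertexOf_lt (hn : 0 < n) (e : ℕ) : vertexOf n e < n := Nat.mod_lt _ hn

theorem callerOf_lt (hn : 0 < n) (e : ℕ) : callerOf n e < n := Nat.mod_lt _ hn

theorem timeOf_lt {e : ℕ} (he : e < n * n * n) : timeOf n e < n :=
  Nat.div_lt_of_lt_mul (Nat.div_lt_of_lt_mul (by rwa [← mul_assoc]))

/-- The call that informs `x` according to a timing. -/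
def codeOf (s : Fin n) (t : Fin n → ℕ) (y : Fin n → Fin n) (x : Fin n) : ℕ :=
  (t x * n + (if x = s then s else y x : Fin n)) * n + x

theorem timeOf_codeOf (t : Fin n → ℕ) (y : Fin n → Fin n) (x : Fin n) :
    timeOf n (codeOf s t y x) = t x := timeOf_mk x.2 (Fin.is_lt _)

theorem IsTiming.isSolution {t : Fin n → ℕ} {y : Fin n → Fin n} (h : IsTiming G s t y)
    (ht : ∀ x, t x < n) :
    IsSolution n (Admissible G s) (fun x => if hx : x < n then codeOf s t y ⟨x, hx⟩ else 0) where
  lt x hx := by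
    rw [dif_pos hx]
    have h1 := ht ⟨x, hx⟩
    have h2 := (if (⟨x, hx⟩ : Fin n) = s then s else y ⟨x, hx⟩ : Fin n).2
    refine mul_add_lt ?_ hx
    nlinarith
  vertex x hx := by rw [dif_pos hx]; exact vertexOf_mk hx
  mem x hx := by
    rw [dif_pos hx]
    have hv : vertexOf n (codeOf s t y ⟨x, hx⟩) = x := vertexOf_mk hx
    have hc : callerOf n (codeOf s t y ⟨x, hx⟩) = (if (⟨x, hx⟩ : Fin n) = s then s else y ⟨x, hx⟩ :
      Fin n) := callerOf_mk hx (Fin.is_lt _)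
    by_cases hs : (⟨x, hx⟩ : Fin n) = s
    · rw [if_pos hs] at hc
      refine .inl ⟨?_, hc, ?_⟩
      · rw [hv, ← hs]
      · rw [timeOf_codeOf, hs, h.source]
    · rw [if_neg hs] at hc
      refine .inr ⟨?_, ?_, ?_⟩
      · rw [hv]
        rintro rfl
        exact hs rfl
      · rw [timeOf_codeOf]
        exact ((Nat.zero_le _).trans_lt (h.lt _ hs)).ne'
      · simp only [hv, hc]
        exact ⟨hx, Fin.is_lt _, h.adj _ hs⟩
  compatible x hx x' hx' := by
    rw [dif_pos hx, dif_pos hx']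
    by_cases hxx : x = x'
    · subst hxx; exact .inl rfl
    have hne : (⟨x, hx⟩ : Fin n) ≠ ⟨x', hx'⟩ := fun h => hxx (Fin.mk.inj h)
    have hv : ∀ x, vertexOf n (codeOf s t y x) = x := fun x => vertexOf_mk x.2
    have hc : ∀ x, callerOf n (codeOf s t y x) = (if x = s then s else y x : Fin n) :=
      fun x => callerOf_mk x.2 (Fin.is_lt _)
    -- Serves both precedence clauses of `Compatible`. The source is its own caller, hence never has
    -- a different vertex as caller.
    have key : ∀ u u' : Fin n, u ≠ u' → (if u = s then s else y u) = u' → t u' < t u := by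
      intro u u' hu he
      by_cases hus : u = s
      · rw [if_pos hus] at he
        exact absurd (hus.trans he) hu
      · rw [if_neg hus] at he
        rw [← he]
        exact h.lt u hus
    refine .inr ⟨?_, ?_, ?_, ?_⟩
    · rw [hv, hv]; exact hxx
    · rw [hc, hv, timeOf_codeOf, timeOf_codeOf]
      exact fun he => key _ _ hne (Fin.ext he)
    · rw [hc, hv, timeOf_codeOf, timeOf_codeOf]
      exact fun he => key _ _ hne.symm (Fin.ext he)
    · rw [hc, hc, timeOf_codeOf, timeOf_codeOf]
      intro he htt
      have he := Fin.ext he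
      -- The fictitious call of the source to itself cannot clash with a call made by the source:
      -- the former has time `0`, the latter positive time.
      by_cases h1 : (⟨x, hx⟩ : Fin n) = s
      · have h2 : (⟨x', hx'⟩ : Fin n) ≠ s := fun h2 => hne (h1.trans h2.symm)
        have := h.lt _ h2
        rw [← htt, h1, h.source] at this
        omega
      · by_cases h2 : (⟨x', hx'⟩ : Fin n) = s
        · have := h.lt _ h1
          rw [htt, h2, h.source] at this
          omega
        · rw [if_neg h1, if_neg h2] at he
          exact hne (h.ne _ h1 _ h2 he htt)

/-- That a caller is informed before it calls is read off from the compatibility of the call to `x`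
with the call that informs the caller of `x`. -/
theorem IsSolution.isTiming {a : ℕ → ℕ} (h : IsSolution n (Admissible G s) a) :
    IsTiming G s (fun x => timeOf n (a x)) (fun x => ⟨callerOf n (a x), callerOf_lt s.pos _⟩) := by
  have hu : ∀ x : Fin n, x ≠ s → timeOf n (a x) ≠ 0 ∧
      G.Adj x ⟨callerOf n (a x), callerOf_lt s.pos _⟩ := by
    intro x hx
    have hv := h.vertex x x.2
    rcases h.mem x x.2 with h1 | ⟨h1, h2, h3, h4, h5⟩
    · exact absurd (Fin.ext (hv.symm.trans h1.1)) hx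
    · refine ⟨h2, ?_⟩
      simpa only [hv] using h5
  refine ⟨?_, fun x hx => (hu x hx).2, fun x hx => ?_, fun x hx x' hx' he ht => ?_⟩
  · rcases h.mem s s.2 with h1 | h1
    · exact h1.2.2
    · exact absurd (h.vertex s s.2) h1.1
  · have hne := (hu x hx).2.ne
    rcases h.compatible x x.2 _ (callerOf_lt s.pos (a x)) with h1 | h1
    · have h2 := congrArg (vertexOf n) h1
      rw [h.vertex x x.2, h.vertex _ (callerOf_lt s.pos _)] at h2
      exact absurd (Fin.ext h2) hne
    · refine h1.2.1 ?_
      rw [h.vertex _ (callerOf_lt s.pos _)]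
  · rcases h.compatible x x.2 x' x'.2 with h1 | h1
    · have h2 := congrArg (vertexOf n) h1
      rw [h.vertex x x.2, h.vertex x' x'.2] at h2
      exact Fin.ext h2
    · exact absurd ht (h1.2.2.2 (Fin.mk.inj he))

theorem Admissible.position_le {k : ℕ} {v : Equiv.Perm (Fin n)} (hv : IsBandwidthOrdering G k v)
    {e : ℕ} (he : Admissible G s e) {i j : Fin n} (hi : vertexOf n e = v i)
    (hj : callerOf n e = v j) : |(i : ℤ) - j| ≤ k := by
  rcases he with ⟨h1, h2, -⟩ | ⟨-, -, h1, h2, h3⟩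
  · have : v i = v j := Fin.ext (by rw [← hi, ← hj, h1, h2])
    rw [v.injective this]
    simp
  · apply hv
    simpa only [hi, hj] using h3

/-- A vertex and its caller are at most `k` positions apart, so two calls sharing a caller have
vertices at most `2 * k` apart. Beyond that distance the vertices differ and the premise of every
other clause of `Compatible` fails. -/
theorem compatible_of_far {k : ℕ} {v : Equiv.Perm (Fin n)} (hv : IsBandwidthOrdering G k v)
    {e f : ℕ} (he : Admissible G s e) (hf : Admissible G s f) {i j : Fin n}
    (hi : vertexOf n e = v i) (hj : vertexOf n f = v j) (hij : (i : ℕ) + (2 * k + 1) ≤ j) :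
    Compatible n f e := by
  obtain ⟨l, hl⟩ := v.surjective ⟨callerOf n e, callerOf_lt s.pos e⟩
  obtain ⟨l', hl'⟩ := v.surjective ⟨callerOf n f, callerOf_lt s.pos f⟩
  have hl : callerOf n e = v l := by rw [hl]
  have hl' : callerOf n f = v l' := by rw [hl']
  have h1 := abs_le.mp (he.position_le hv hi hl)
  have h2 := abs_le.mp (hf.position_le hv hj hl')
  have aux : ∀ {p q : Fin n}, (v p : ℕ) = v q → p = q := fun h => v.injective (Fin.ext h)
  refine .inr ⟨?_, ?_, ?_, ?_⟩
  · rw [hi, hj]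
    intro h
    have := aux h
    subst this
    omega
  · rw [hi, hl']
    intro h
    have := aux h
    subst this
    omega
  · rw [hj, hl]
    intro h
    have := aux h
    subst this
    omega
  · rw [hl, hl']
    intro h
    have := aux h
    subst this
    omega

/-- The constraint satisfaction problem is decided by playing with windows. -/
theorem exists_solution_of_survives_of_bandwidth {k : ℕ} {v : Equiv.Perm (Fin n)}
    (hv : IsBandwidthOrdering G k v) {A : ℕ → Prop} (hA : ∀ e, A e → Admissible G s e) {p : ℕ}
    (hp : Survives n (2 * k + 1) A n p) : ∃ a, IsSolution n A a := by
  -- The value `0` outside the range is never requested.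
  refine exists_solution_of_survives (π := fun i => if h : i < n then v ⟨i, h⟩ else 0)
    (by omega) (fun i hi => ?_) (fun x hx => ?_) (fun i j hij hj e f he hf hi' hj' => ?_) hp
  · simp [hi]
  · obtain ⟨i, hi⟩ := v.surjective ⟨x, hx⟩
    exact ⟨i, i.2, by simp [hi]⟩
  · have hi : i < n := by omega
    rw [dif_pos hi] at hi'
    rw [dif_pos hj] at hj'
    exact compatible_of_far hv (hA e he) (hA f hf) hi' hj' hij

/-- One call per round shows that the optimum is at most `n - 1`; hence it is attained, and the
times of an optimal scheme are small enough to be coded. -/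
theorem broadcastTime_spec (hG : G.Connected) (s : Fin n) :
    ∃ a, IsSolution n (Admissible G s) a ∧ ∀ x < n, timeOf n (a x) ≤ broadcastTime G s := by
  obtain ⟨t, y, h, ht⟩ := exists_timing_lt hG s
  have hn := s.pos
  have h1 : n - 1 ∈ {r | ∃ c : Calls (Fin n), IsScheme G s r c} :=
    ⟨_, h.isScheme fun x => by have := ht x; omega⟩
  have h2 : broadcastTime G s ≤ n - 1 := Nat.sInf_le h1
  obtain ⟨c, hc⟩ : broadcastTime G s ∈ {r | ∃ c : Calls (Fin n), IsScheme G s r c} :=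
    Nat.sInf_mem ⟨_, h1⟩
  obtain ⟨t, y, h, ht⟩ := hc.exists_timing
  refine ⟨_, h.isSolution fun x => by have := ht x; omega, fun x hx => ?_⟩
  rw [dif_pos hx, timeOf_codeOf]
  exact ht _

theorem broadcastTime_le {a : ℕ → ℕ} (h : IsSolution n (Admissible G s) a) {r : ℕ}
    (hr : ∀ x < n, timeOf n (a x) ≤ r) : broadcastTime G s ≤ r :=
  Nat.sInf_le ⟨_, h.isTiming.isScheme fun x => hr x x.2⟩

end Admissible

/-! ## The program -/

namespace Stmt

variable {ν : Type} [DecidableEq ν]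

/-- Execution of several programs one after the other. -/
def block (l : List (Stmt ν)) : Stmt ν := l.foldr seq skip

@[simp] theorem run_block_nil (σ : State ν) : (block []).run σ = σ := run_skip σ

@[simp] theorem run_block_cons (σ : State ν) (p : Stmt ν) (l : List (Stmt ν)) :
    (block (p :: l)).run σ = (block l).run (p.run σ) := run_seq σ p _

theorem run_ite_of_holds {σ : State ν} {e : Expr ν} (h : e.Holds σ) (p q : Stmt ν) :
    (ite e p q).run σ = p.run σ := by rw [run_ite, if_pos h]

theorem run_ite_of_not_holds {σ : State ν} {e : Expr ν} (h : ¬ e.Holds σ) (p q : Stmt ν) :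
    (ite e p q).run σ = q.run σ := by rw [run_ite, if_neg h]

end Stmt

/-- The variables of the program. -/
inductive Var : Type
  | n | s | nn | N | m | M | QA | QH
  | ctr | e | w | t | y | x | e' | t' | y' | x' | q | p | j | ok | L | base | a | z | found | idx
  | feas | i | g | r | k | u | v | row
  deriving DecidableEq

open TelephoneBroadcast.Stmt TelephoneBroadcast.Expr

set_option linter.constructorNameAsVariable false

/-! ### Multiplication and division by bounded loops. -/

/-- `d := a * b` -/
def mulInto (d a b : Var) : Stmt Var :=
  block [set d (lit 0), loop .ctr b (set d (add (var d) (var a)))]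

/-- `q := r / b` and `r := r % b` -/
def divMod (q r b : Var) : Stmt Var :=
  block [set q (lit 0),
    loop .ctr .M (ite (lt (var r) (var b)) skip
      (block [set q (add (var q) (lit 1)), set r (sub (var r) (var b))]))]

theorem run_mulInto {d a b : Var} (hda : a ≠ d) (hdb : b ≠ d) (hd : d ≠ .ctr) (ha : a ≠ .ctr)
    (σ : State Var) : ((mulInto d a b).run σ).reg d = σ.reg a * σ.reg b := by
  have h := run_loop_induction (σ := σ.set d 0) (i := .ctr) (b := b)
    (p := set d (add (var d) (var a))) (fun j τ => τ.reg d = σ.reg a * j) (by simp) (by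
      intro j _ τ hf _ hI
      have h1 : τ.reg a = σ.reg a := by
        rw [hf a (by simp [writes, hda, ha])]; simp [hda]
      simp [hd, ha, h1, hI, Nat.mul_succ])
  simpa [mulInto, hdb] using h

/-- Repeated subtraction preserves `r + q * b`. As loops are bounded, `M` rounds are always made;
once `r < b` the remaining ones are idle, so it suffices that `M` is at least the quotient. -/
theorem run_divMod {q r b : Var} (hqr : q ≠ r) (hbq : b ≠ q) (hbr : b ≠ r) (hq : q ≠ .ctr)
    (hr : r ≠ .ctr) (hb : b ≠ .ctr) (hMq : q ≠ .M) {σ : State Var}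
    (h0 : 0 < σ.reg b) (hM : σ.reg r / σ.reg b ≤ σ.reg .M) :
    ((divMod q r b).run σ).reg q = σ.reg r / σ.reg b ∧
      ((divMod q r b).run σ).reg r = σ.reg r % σ.reg b := by
  have h := run_loop_induction (σ := σ.set q 0) (i := .ctr) (b := .M)
    (p := ite (lt (var r) (var b)) skip
      (block [set q (add (var q) (lit 1)), set r (sub (var r) (var b))]))
    (fun j τ => τ.reg q = min j (σ.reg r / σ.reg b) ∧ τ.reg r + τ.reg q * σ.reg b = σ.reg r)
    (by simp [hqr.symm]) (by
      intro j _ τ hf _ ⟨h1, h2⟩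
      have h3 : τ.reg b = σ.reg b := by
        rw [hf b (by simp [writes, block, hbq, hbr, hb])]; simp [hbq]
      have h4 : (τ.reg r + τ.reg q * σ.reg b) / σ.reg b = τ.reg r / σ.reg b + τ.reg q :=
        Nat.add_mul_div_right _ _ h0
      rw [h2] at h4
      by_cases hlt : τ.reg r < σ.reg b
      · rw [run_ite_of_holds (by simpa [hr, hb, h3] using hlt)]
        rw [Nat.div_eq_of_lt hlt] at h4
        simp only [run_skip, State.set_reg, hq, hr, if_false]
        exact ⟨by omega, h2⟩
      · rw [run_ite_of_not_holds (by simpa [hr, hb, h3] using hlt)]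
        have h5 : 1 ≤ τ.reg r / σ.reg b := (Nat.one_le_div_iff h0).mpr (by omega)
        have h6 : (τ.reg q + 1) * σ.reg b = τ.reg q * σ.reg b + σ.reg b := by ring
        simp only [run_block_cons, run_set, run_block_nil, State.set_reg, eval_add, eval_sub,
          eval_var, eval_lit, hq, hr, hb, hqr, hqr.symm, hbq, if_false, if_true, h3]
        refine ⟨by omega, ?_⟩
        rw [h6]
        omega)
  have hrun : (divMod q r b).run σ = (loop .ctr .M (ite (lt (var r) (var b)) skip
      (block [set q (add (var q) (lit 1)), set r (sub (var r) (var b))]))).run (σ.set q 0) := by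
    simp [divMod]
  rw [State.set_reg, if_neg hMq.symm, ← hrun] at h
  obtain ⟨h1, h2⟩ := h
  rw [min_eq_right hM] at h1
  refine ⟨h1, ?_⟩
  rw [h1] at h2
  have := Nat.div_add_mod' (σ.reg r) (σ.reg b)
  omega

/-! ### Constants, decoding of calls, and the coherence test. -/

/-- The variables that are constant after the initialization. -/
def constants : List Var := [.n, .s, .nn, .N, .m, .M, .QA, .QH]

/-- The constants have their intended values: `n` vertices, windows of length `m`, source `s`. -/
structure Layout (n m s : ℕ) (σ : State Var) : Prop where
  reg_n : σ.reg .n = n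
  reg_s : σ.reg .s = s
  reg_nn : σ.reg .nn = n * n
  reg_N : σ.reg .N = n * n * n
  reg_m : σ.reg .m = m
  reg_M : σ.reg .M = (n * n * n) ^ m
  reg_QA : σ.reg .QA = n * n + 2
  reg_QH : σ.reg .QH = n * n + 2 + n * n * n

/-- The program does not write to the constants. -/
def KeepsConstants (p : Stmt Var) : Bool := constants.all fun r => !p.writes r

/-- The hypothesis `hf` has the form of the frame fact supplied by `run_loop_induction`, so the
layout can be carried into loop bodies. -/
theorem Layout.of_writes {n m s : ℕ} {σ τ : State Var} (h : Layout n m s σ) {p : Stmt Var}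
    (hf : ∀ r, p.writes r = false → τ.reg r = σ.reg r) (hp : KeepsConstants p = true) :
    Layout n m s τ := by
  simp only [KeepsConstants, constants, List.all_cons, List.all_nil, Bool.and_true,
    Bool.and_eq_true, Bool.not_eq_true'] at hp
  obtain ⟨h1, h2, h3, h4, h5, h6, h7, h8⟩ := hp
  exact ⟨(hf _ h1).trans h.reg_n, (hf _ h2).trans h.reg_s, (hf _ h3).trans h.reg_nn, (hf _ h4).trans h.reg_N,
    (hf _ h5).trans h.reg_m, (hf _ h6).trans h.reg_M, (hf _ h7).trans h.reg_QA, (hf _ h8).trans h.reg_QH⟩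

theorem Layout.run {n m s : ℕ} {σ : State Var} (h : Layout n m s σ) {p : Stmt Var}
    (hp : KeepsConstants p = true) : Layout n m s (p.run σ) :=
  h.of_writes (fun _ hr => run_reg_of_writes hr σ) hp

theorem Layout.set {n m s : ℕ} {σ : State Var} (h : Layout n m s σ) {r : Var} (x : ℕ)
    (hr : KeepsConstants (.set r (.lit 0)) = true) : Layout n m s (σ.set r x) :=
  h.of_writes (p := .set r (.lit 0)) (fun r' hr' => by
    simp only [writes, decide_eq_false_iff_not] at hr'
    simp [hr']) hr

theorem Layout.setMem {n m s : ℕ} {σ : State Var} (h : Layout n m s σ) (a x : ℕ) :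
    Layout n m s (σ.setMem a x) := ⟨h.reg_n, h.reg_s, h.reg_nn, h.reg_N, h.reg_m, h.reg_M, h.reg_QA, h.reg_QH⟩

/-- Splits the call `e` into its vertex `x`, its caller `y` and its time `t`; moreover
`w = t * n + y`. -/
def decode : Stmt Var :=
  block [set .x (var .e), divMod .w .x .n, set .y (var .w), divMod .t .y .n]

theorem run_decode {n m s : ℕ} {σ : State Var} (h : Layout n m s σ) (hn : 0 < n)
    (he : σ.reg .e ≤ (n * n * n) ^ m) :
    (decode.run σ).reg .x = vertexOf n (σ.reg .e) ∧ (decode.run σ).reg .y = callerOf n (σ.reg .e) ∧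
      (decode.run σ).reg .t = timeOf n (σ.reg .e) ∧ (decode.run σ).reg .w = σ.reg .e / n := by
  have h1 := h.set (σ.reg .e) (r := .x) rfl
  obtain ⟨a1, a2⟩ := run_divMod (q := .w) (r := .x) (b := .n) (by decide) (by decide) (by decide)
    (by decide) (by decide) (by decide) (by decide) (σ := σ.set .x (σ.reg .e)) (by rw [h1.reg_n]; exact hn)
    (by rw [h1.reg_n, h1.reg_M]; simpa using (Nat.div_le_self _ _).trans he)
  have h2 := h1.run (p := divMod .w .x .n) rfl
  set σ₁ := (divMod .w .x .n).run (σ.set .x (σ.reg .e)) with hσ₁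
  rw [h1.reg_n] at a1 a2
  simp only [State.set_reg, if_true] at a1 a2
  have h3 := h2.set (σ₁.reg .w) (r := .y) rfl
  obtain ⟨b1, b2⟩ := run_divMod (q := .t) (r := .y) (b := .n) (by decide) (by decide) (by decide)
    (by decide) (by decide) (by decide) (by decide) (σ := σ₁.set .y (σ₁.reg .w))
    (by rw [h3.reg_n]; exact hn)
    (by rw [h3.reg_n, h3.reg_M]; simpa [a1] using (Nat.div_le_self _ _).trans ((Nat.div_le_self _ _).trans he))
  rw [h3.reg_n] at b1 b2
  simp only [State.set_reg, if_true, a1] at b1 b2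
  have hrun : decode.run σ = (divMod .t .y .n).run (σ₁.set .y (σ₁.reg .w)) := by
    simp [decode, hσ₁]
  rw [hrun, a1, b1, b2, run_reg_of_writes rfl, run_reg_of_writes rfl]
  simp only [State.set_reg, reduceCtorEq, if_false, a1, a2]
  exact ⟨rfl, rfl, rfl, trivial⟩

/-- The test whether the call `e'` (decoded in `t'`, `y'`, `x'`) is compatible with the call `e`. -/
def compatibleExpr : Expr Var :=
  .or (.eq (var .e') (var .e)) (.and (.not (.eq (var .x') (var .x)))
    (.and (.imp (.eq (var .y') (var .x)) (.lt (var .t) (var .t')))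
    (.and (.imp (.eq (var .y) (var .x')) (.lt (var .t') (var .t)))
      (.imp (.eq (var .y') (var .y)) (.not (.eq (var .t') (var .t)))))))

/-- Tests the compatibility of the last digit of `q`, which is removed, with the decoded call
`e'`. -/
def checkDigit : Stmt Var :=
  block [set .e (var .q), divMod .q .e .N, decode, ite compatibleExpr skip (set .ok (lit 0))]

/-- `ok` is set to the truth value of `Coherent` for the window `p`. -/
def check : Stmt Var :=
  block [set .e (var .p), divMod .q .e .N, set .ok (load (add (var .QA) (var .e))), decode,
    set .e' (var .e), set .t' (var .t), set .y' (var .y), set .x' (var .x), set .q (var .p),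
    loop .j .m checkDigit]

theorem run_divMod_digit {n m s : ℕ} {σ : State Var} (h : Layout n m s σ) (hn : 0 < n)
    (he : σ.reg .e < (n * n * n) ^ m) :
    ((divMod .q .e .N).run σ).reg .q = σ.reg .e / (n * n * n) ∧
      ((divMod .q .e .N).run σ).reg .e = σ.reg .e % (n * n * n) := by
  have := run_divMod (q := .q) (r := .e) (b := .N) (by decide) (by decide) (by decide)
    (by decide) (by decide) (by decide) (by decide) (σ := σ) (by rw [h.reg_N]; positivity)
    (by rw [h.reg_N, h.reg_M]; exact (Nat.div_le_self _ _).trans he.le)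
  rwa [h.reg_N] at this

theorem digit_le {n m : ℕ} (hn : 0 < n) (hm : 0 < m) (b : ℕ) :
    b % (n * n * n) ≤ (n * n * n) ^ m :=
  (Nat.mod_lt _ (by positivity)).le.trans (Nat.le_self_pow hm.ne' _)

theorem run_checkDigit {n m s : ℕ} {σ : State Var} (h : Layout n m s σ) (hn : 0 < n) (hm : 0 < m)
    (hq : σ.reg .q < (n * n * n) ^ m) (ht : σ.reg .t' = timeOf n (σ.reg .e'))
    (hy : σ.reg .y' = callerOf n (σ.reg .e')) (hx : σ.reg .x' = vertexOf n (σ.reg .e')) :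
    (checkDigit.run σ).reg .q = σ.reg .q / (n * n * n) ∧
      ((checkDigit.run σ).reg .ok ≠ 0 ↔
        σ.reg .ok ≠ 0 ∧ Compatible n (σ.reg .e') (σ.reg .q % (n * n * n))) := by
  have l6 := h.set (σ.reg .q) (r := .e) rfl
  have g1 := run_divMod_digit l6 hn (by simpa using hq)
  simp only [State.set_reg, if_true] at g1
  have l7 := l6.run (p := divMod .q .e .N) rfl
  obtain ⟨c1, c2, c3, -⟩ := run_decode l7 hn (by rw [g1.2]; exact digit_le hn hm _)
  rw [g1.2] at c1 c2 c3
  have k : ∀ r, (decode.writes r = false) → ((divMod .q .e .N).writes r = false) → r ≠ .e →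
      (decode.run ((divMod .q .e .N).run (σ.set .e (σ.reg .q)))).reg r = σ.reg r := by
    intro r hr1 hr2 hr3
    rw [run_reg_of_writes hr1, run_reg_of_writes hr2]
    simp [hr3]
  have k1 : (decode.run ((divMod .q .e .N).run (σ.set .e (σ.reg .q)))).reg .e =
      σ.reg .q % (n * n * n) := by
    rw [run_reg_of_writes rfl, g1.2]
  have k2 : (decode.run ((divMod .q .e .N).run (σ.set .e (σ.reg .q)))).reg .q =
      σ.reg .q / (n * n * n) := by
    rw [run_reg_of_writes rfl, g1.1]
  have k3 := k .e' rfl rfl (by decide)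
  have k4 := k .t' rfl rfl (by decide)
  have k5 := k .y' rfl rfl (by decide)
  have k6 := k .x' rfl rfl (by decide)
  have k7 := k .ok rfl rfl (by decide)
  have hrun : checkDigit.run σ = (ite compatibleExpr skip (set .ok (lit 0))).run
      (decode.run ((divMod .q .e .N).run (σ.set .e (σ.reg .q)))) := by
    simp only [checkDigit, run_block_cons, run_set, eval_var, run_block_nil]
  rw [hrun]
  generalize decode.run ((divMod .q .e .N).run (σ.set .e (σ.reg .q))) = τ at *
  have hc : compatibleExpr.Holds τ ↔ Compatible n (σ.reg .e') (σ.reg .q % (n * n * n)) := by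
    simp only [compatibleExpr, holds_or, holds_and, holds_imp, holds_not, holds_eq, holds_lt,
      eval_var, c1, c2, c3, k1, k3, k4, k5, k6, ht, hy, hx]
    rfl
  by_cases hcomp : compatibleExpr.Holds τ
  · rw [run_ite_of_holds hcomp, run_skip]
    have := hc.mp hcomp
    exact ⟨k2, by rw [k7]; exact (and_iff_left this).symm⟩
  · rw [run_ite_of_not_holds hcomp, run_set]
    have := hc.not.mp hcomp
    refine ⟨by simpa using k2, by simp [this]⟩

theorem run_check {n m s : ℕ} {σ : State Var} (h : Layout n m s σ) (hn : 0 < n) (hm : 0 < m)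
    (hp : σ.reg .p < (n * n * n) ^ m) :
    (check.run σ).reg .ok ≠ 0 ↔
      Coherent n m (fun e => σ.mem (n * n + 2 + e) ≠ 0) (σ.reg .p) := by
  have l1 := h.set (σ.reg .p) (r := .e) rfl
  obtain ⟨-, a2⟩ := run_divMod_digit l1 hn (by simpa using hp)
  simp only [State.set_reg, if_true] at a2
  have l2 := l1.run (p := divMod .q .e .N) rfl
  have m1 : ((divMod .q .e .N).run (σ.set .e (σ.reg .p))).mem = σ.mem := run_mem_of_stores rfl _
  have p1 : ((divMod .q .e .N).run (σ.set .e (σ.reg .p))).reg .p = σ.reg .p := by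
    rw [run_reg_of_writes rfl]; simp
  have hrun : check.run σ = (block [set .ok (load (add (var .QA) (var .e))), decode,
    set .e' (var .e), set .t' (var .t), set .y' (var .y), set .x' (var .x), set .q (var .p),
    loop .j .m checkDigit]).run ((divMod .q .e .N).run (σ.set .e (σ.reg .p))) := by
    simp only [check, run_block_cons, run_set, eval_var, run_block_nil]
  rw [hrun]
  generalize (divMod .q .e .N).run (σ.set .e (σ.reg .p)) = σ₁ at *
  have l3 := l2.set (σ.mem (n * n + 2 + σ.reg .p % (n * n * n))) (r := .ok) rfl
  obtain ⟨d1, d2, d3, -⟩ := run_decode l3 hn (by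
    simp only [State.set_reg, reduceCtorEq, if_false, a2]; exact digit_le hn hm _)
  have f1 := run_reg_of_writes (p := decode) (r := .e) rfl
    (σ₁.set .ok (σ.mem (n * n + 2 + σ.reg .p % (n * n * n))))
  have f2 := run_reg_of_writes (p := decode) (r := .ok) rfl
    (σ₁.set .ok (σ.mem (n * n + 2 + σ.reg .p % (n * n * n))))
  have f3 := run_reg_of_writes (p := decode) (r := .p) rfl
    (σ₁.set .ok (σ.mem (n * n + 2 + σ.reg .p % (n * n * n))))
  have l4 := l3.run (p := decode) rfl
  simp only [State.set_reg, reduceCtorEq, if_false, if_true, a2, p1] at d1 d2 d3 f1 f2 f3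
  simp only [run_block_cons, run_set, eval_load, eval_add, eval_var, l2.reg_QA, a2, m1]
  generalize decode.run (σ₁.set .ok (σ.mem (n * n + 2 + σ.reg .p % (n * n * n)))) = σ₂ at *
  simp only [run_block_nil, State.set_reg, reduceCtorEq, if_false, f1, f3, d1, d2, d3]
  have l5 : Layout n m s (((((σ₂.set .e' (σ.reg .p % (n * n * n))).set .t'
      (timeOf n (σ.reg .p % (n * n * n)))).set .y' (callerOf n (σ.reg .p % (n * n * n)))).set .x'
      (vertexOf n (σ.reg .p % (n * n * n)))).set .q (σ.reg .p)) :=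
    ((((l4.set _ rfl).set _ rfl).set _ rfl).set _ rfl).set _ rfl
  have key := run_loop_induction (i := .j) (b := .m) (p := checkDigit)
    (σ := (((((σ₂.set .e' (σ.reg .p % (n * n * n))).set .t'
      (timeOf n (σ.reg .p % (n * n * n)))).set .y' (callerOf n (σ.reg .p % (n * n * n)))).set .x'
      (vertexOf n (σ.reg .p % (n * n * n)))).set .q (σ.reg .p)))
    -- After `j` rounds `q` has lost its last `j` digits. Round `0` compares the newest call with
    -- itself, which always succeeds.
    (fun j τ => τ.reg .q = σ.reg .p / (n * n * n) ^ j ∧ (τ.reg .ok ≠ 0 ↔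
      (σ.mem (n * n + 2 + σ.reg .p % (n * n * n)) ≠ 0 ∧
        ∀ i < j, Compatible n (σ.reg .p % (n * n * n)) (σ.reg .p / (n * n * n) ^ i % (n * n * n)))))
    (by simp [f2]) (by
      intro j _ τ hf _ ⟨h1, h2⟩
      have g1 := hf .e' rfl
      have g2 := hf .t' rfl
      have g3 := hf .y' rfl
      have g4 := hf .x' rfl
      simp only [State.set_reg, reduceCtorEq, if_false, if_true] at g1 g2 g3 g4
      have lτ := (l5.of_writes hf rfl).set j (r := .j) rfl
      have := run_checkDigit lτ hn hm
        (by simpa [h1] using (Nat.div_le_self _ _).trans_lt hp) (by simp [g1, g2])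
        (by simp [g1, g3]) (by simp [g1, g4])
      simp only [State.set_reg, reduceCtorEq, if_false, g1, h1] at this
      rw [this.1, this.2, h2, Nat.div_div_eq_div_mul, pow_succ, Nat.forall_lt_succ_right]
      exact ⟨rfl, and_assoc⟩)
  rw [l5.reg_m] at key
  obtain ⟨-, key⟩ := key
  rw [key]
  rfl

/-! ### The game on windows, played on marked memory cells. -/

/-- Marks the coherent windows. -/
def initWindows : Stmt Var :=
  loop .p .M (block [check, store (add (var .QH) (var .p)) (var .ok)])

/-- `ok` is set to the truth value of the statement that for each requested vertex, the window `p`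
has a marked successor. -/
def respond : Stmt Var :=
  block [mulInto .base .p .N, divMod .z .base .M, set .ok (lit 1),
    loop .a .n (block [set .found (lit 0), set .idx (add (var .QH) (add (var .base) (var .a))),
      loop .z .nn (block [set .found (add (var .found) (load (var .idx))),
        set .idx (add (var .idx) (var .n))]),
      ite (var .found) skip (set .ok (lit 0))])]

/-- Repeatedly removes the marks of the windows that cannot respond to all requests. -/
def sweep : Stmt Var :=
  loop .L .n (loop .p .M
    (block [respond, ite (var .ok) skip (store (add (var .QH) (var .p)) (lit 0))]))

/-- `feas` is set to the truth value of the statement that there is a marked window. -/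
def feasible : Stmt Var :=
  block [set .feas (lit 0),
    loop .p .M (set .feas (add (var .feas) (load (add (var .QH) (var .p)))))]

/-- Decides whether there is a solution. -/
def test : Stmt Var := block [initWindows, sweep, feasible]

/-- The calls that are marked in memory. -/
def calls (n : ℕ) (mem : ℕ → ℕ) (e : ℕ) : Prop := mem (n * n + 2 + e) ≠ 0

/-- The windows that are marked in memory. -/
def windows (n : ℕ) (mem : ℕ → ℕ) (p : ℕ) : Prop := mem (n * n + 2 + n * n * n + p) ≠ 0

theorem Coherent.congr {n m : ℕ} (hn : 0 < n) {A A' : ℕ → Prop}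
    (h : ∀ e < n * n * n, A e ↔ A' e) {p : ℕ} : Coherent n m A p ↔ Coherent n m A' p := by
  rw [Coherent, Coherent, h _ (Nat.mod_lt _ (by positivity))]

theorem run_initWindows {n m s : ℕ} {σ : State Var} (h : Layout n m s σ) (hn : 0 < n)
    (hm : 0 < m) :
    (∀ p < (n * n * n) ^ m, windows n (initWindows.run σ).mem p ↔
      Coherent n m (calls n σ.mem) p) ∧
    ∀ b < n * n + 2 + n * n * n, (initWindows.run σ).mem b = σ.mem b := by
  have key := run_loop_induction (i := .p) (b := .M) (σ := σ)
    (p := block [check, store (add (var .QH) (var .p)) (var .ok)])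
    (fun j τ => (∀ p < j, windows n τ.mem p ↔ Coherent n m (calls n σ.mem) p) ∧
      ∀ b < n * n + 2 + n * n * n, τ.mem b = σ.mem b) (by simp) (by
      intro j hj τ hf _ ⟨h1, h2⟩
      rw [h.reg_M] at hj
      have lτ := (h.of_writes hf rfl).set j (r := .p) rfl
      have hc := run_check lτ hn hm (by simpa using hj)
      simp only [State.set_reg, if_true, State.set_mem] at hc
      rw [Coherent.congr (A' := calls n σ.mem) hn (by
        intro e he; rw [calls, h2 _ (by omega)])] at hc
      have l1 := lτ.run (p := check) rfl
      have m1 : (check.run (τ.set .p j)).mem = τ.mem := run_mem_of_stores rfl _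
      have p1 : (check.run (τ.set .p j)).reg .p = j := by rw [run_reg_of_writes rfl]; simp
      simp only [run_block_cons, run_store, run_block_nil, eval_add, eval_var, l1.reg_QH, p1]
      refine ⟨fun p hp => ?_, fun b hb => ?_⟩
      · by_cases hpj : p = j
        · subst hpj
          simp only [windows, State.setMem_mem, if_true]
          exact hc
        · rw [← h1 p (by omega), windows, windows, State.setMem_mem, if_neg (by omega), m1]
      · rw [State.setMem_mem, if_neg (by omega), m1, h2 b hb])
  rwa [h.reg_M] at key

theorem run_respond {n m s : ℕ} {σ : State Var} (h : Layout n m s σ) (hn : 0 < n) (hm : 0 < m)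
    (hp : σ.reg .p < (n * n * n) ^ m) :
    (respond.run σ).reg .ok ≠ 0 ↔ ∀ x < n, ∃ z < n * n,
      windows n σ.mem (σ.reg .p * (n * n * n) % (n * n * n) ^ m + (z * n + x)) := by
  have hM : 0 < (n * n * n) ^ m := by positivity
  have b1 := run_mulInto (d := .base) (a := .p) (b := .N) (by decide) (by decide) (by decide)
    (by decide) σ
  rw [h.reg_N] at b1
  have l1 := h.run (p := mulInto .base .p .N) rfl
  have m1 : ((mulInto .base .p .N).run σ).mem = σ.mem := run_mem_of_stores rfl _
  have hrun : respond.run σ = (block [divMod .z .base .M, set .ok (lit 1),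
    loop .a .n (block [set .found (lit 0), set .idx (add (var .QH) (add (var .base) (var .a))),
      loop .z .nn (block [set .found (add (var .found) (load (var .idx))),
        set .idx (add (var .idx) (var .n))]),
      ite (var .found) skip (set .ok (lit 0))])]).run ((mulInto .base .p .N).run σ) := by
    simp only [respond, run_block_cons]
  rw [hrun]
  generalize (mulInto .base .p .N).run σ = σ₁ at *
  obtain ⟨-, b2⟩ := run_divMod (q := .z) (r := .base) (b := .M) (by decide) (by decide) (by decide)
    (by decide) (by decide) (by decide) (by decide) (σ := σ₁) (by rw [l1.reg_M]; exact hM)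
    -- The quotient is discarded, but it must not exceed `M` for the division loop to finish: it is
    -- at most `N`, and `N ≤ N ^ m = M`.
    (by
      rw [l1.reg_M, b1]
      refine (Nat.div_le_of_le_mul ?_).trans (Nat.le_self_pow hm.ne' (n * n * n))
      exact Nat.mul_le_mul_right _ hp.le)
  rw [l1.reg_M, b1] at b2
  have l2 := l1.run (p := divMod .z .base .M) rfl
  have m2 : ((divMod .z .base .M).run σ₁).mem = σ.mem := by rw [run_mem_of_stores rfl, m1]
  simp only [run_block_cons, run_set, run_block_nil, eval_lit]
  generalize (divMod .z .base .M).run σ₁ = σ₂ at *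
  generalize σ.reg .p * (n * n * n) % (n * n * n) ^ m = B at *
  have l3 := l2.set 1 (r := .ok) rfl
  have key := run_loop_induction (i := .a) (b := .n) (σ := σ₂.set .ok 1)
    (p := block [set .found (lit 0), set .idx (add (var .QH) (add (var .base) (var .a))),
      loop .z .nn (block [set .found (add (var .found) (load (var .idx))),
        set .idx (add (var .idx) (var .n))]),
      ite (var .found) skip (set .ok (lit 0))])
    (fun j τ => τ.reg .ok ≠ 0 ↔ ∀ x < j, ∃ z < n * n, windows n σ.mem (B + (z * n + x)))
    (by simp) (by
      intro x _ τ hf hmem hI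
      have hmem := hmem rfl
      have lτ := l3.of_writes hf rfl
      have hb := hf .base rfl
      simp only [State.set_reg, reduceCtorEq, if_false, b2] at hb
      rw [State.set_mem, m2] at hmem
      simp only [run_block_cons, run_set, run_block_nil, eval_lit, eval_add, eval_var,
        State.set_reg, reduceCtorEq, if_false, if_true, lτ.reg_QH, hb]
      have l4 := (((lτ.set x (r := .a) rfl).set 0 (r := .found) rfl).set
        (n * n + 2 + n * n * n + (B + x)) (r := .idx) rfl)
      have inner := run_loop_induction (i := .z) (b := .nn)
        (σ := (((τ.set .a x).set .found 0).set .idx (n * n + 2 + n * n * n + (B + x))))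
        (p := block [set .found (add (var .found) (load (var .idx))),
          set .idx (add (var .idx) (var .n))])
        -- Successors for the same vertex `x` and consecutive `z` lie `n` cells apart, so the
        -- address is updated by addition. `found` is the sum of their marks.
        (fun j υ => υ.reg .idx = n * n + 2 + n * n * n + (B + (j * n + x)) ∧ (υ.reg .found ≠ 0 ↔
          ∃ z < j, windows n σ.mem (B + (z * n + x)))) (by simp) (by
          intro z _ υ hf hmem' ⟨i1, i2⟩
          have hmem' := hmem' rfl
          simp only [State.set_mem, hmem] at hmem'
          have lυ := l4.of_writes hf rfl
          simp only [run_block_cons, run_set, run_block_nil, eval_load, eval_add, eval_var,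
            State.set_reg, reduceCtorEq, if_false, if_true, i1, lυ.reg_n, State.set_mem, hmem']
          refine ⟨by ring, ?_⟩
          rw [Nat.exists_lt_succ_right, ← i2, windows]
          omega)
      rw [l4.reg_nn] at inner
      obtain ⟨-, inner⟩ := inner
      have o1 := run_reg_of_writes (r := .ok) (p := loop .z .nn (block [set .found (add (var .found)
        (load (var .idx))), set .idx (add (var .idx) (var .n))])) rfl
        (((τ.set .a x).set .found 0).set .idx (n * n + 2 + n * n * n + (B + x)))
      simp only [State.set_reg, reduceCtorEq, if_false] at o1
      generalize Stmt.run (ν := Var) (loop Var.z Var.nn _) _ = υ at *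
      rw [Nat.forall_lt_succ_right, ← hI, ← inner]
      by_cases hfound : (var Var.found).Holds υ
      · rw [run_ite_of_holds hfound, run_skip, o1]
        exact (and_iff_left hfound).symm
      · rw [run_ite_of_not_holds hfound, run_set]
        simp only [holds_var] at hfound
        simp [hfound])
  rwa [l3.reg_n] at key

/-- Marks are removed in place, so a pass may already use removals made earlier in the same pass,
and the marked set need not equal `Survives n m A L` after `L` passes. It is enclosed instead: it
contains every set `W` of coherent windows that is closed under responses, and it is contained in
the windows surviving `L` requests. The two inclusions give the two directions of the feasibility
test. -/
theorem run_sweep {n m s : ℕ} {σ : State Var} (h : Layout n m s σ) (hn : 0 < n) (hm : 0 < m)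
    {A W : ℕ → Prop}
    (h0 : ∀ p < (n * n * n) ^ m, windows n σ.mem p ↔ Coherent n m A p)
    (hW0 : ∀ p, W p → Coherent n m A p)
    (hW : ∀ p, W p → ∀ x < n, ∃ z < n * n,
      W (p * (n * n * n) % (n * n * n) ^ m + (z * n + x))) :
    (∀ p < (n * n * n) ^ m, W p → windows n (sweep.run σ).mem p) ∧
    (∀ p < (n * n * n) ^ m, windows n (sweep.run σ).mem p → Survives n m A n p) ∧
    ∀ b < n * n + 2 + n * n * n, (sweep.run σ).mem b = σ.mem b := by
  have hsucc : ∀ p x z, x < n → z < n * n →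
      p * (n * n * n) % (n * n * n) ^ m + (z * n + x) < (n * n * n) ^ m :=
    fun p x z hx hz => shift_lt hm (mul_add_lt hz hx)
  have key := run_loop_induction (i := .L) (b := .n) (σ := σ)
    (p := loop .p .M
      (block [respond, ite (var .ok) skip (store (add (var .QH) (var .p)) (lit 0))]))
    (fun L τ => (∀ p < (n * n * n) ^ m, W p → windows n τ.mem p) ∧
      (∀ p < (n * n * n) ^ m, windows n τ.mem p → Survives n m A L p) ∧
      ∀ b < n * n + 2 + n * n * n, τ.mem b = σ.mem b)
    ⟨fun p hp hw => (h0 p hp).mpr (hW0 p hw), fun p hp hw => (h0 p hp).mp hw, fun _ _ => rfl⟩ (by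
      intro L _ τ hf _ ⟨i1, i2, i3⟩
      have l1 := (h.of_writes hf rfl).set L (r := .L) rfl
      have inner := run_loop_induction (i := .p) (b := .M) (σ := τ.set .L L)
        (p := block [respond, ite (var .ok) skip (store (add (var .QH) (var .p)) (lit 0))])
        -- During a pass, marked windows below `j` are known to survive `L + 1` requests, the others
        -- only `L`.
        (fun j υ => (∀ p < (n * n * n) ^ m, W p → windows n υ.mem p) ∧
          (∀ p < (n * n * n) ^ m, windows n υ.mem p → Survives n m A L p) ∧
          (∀ p < j, windows n υ.mem p → Survives n m A (L + 1) p) ∧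
          ∀ b < n * n + 2 + n * n * n, υ.mem b = σ.mem b)
        ⟨i1, i2, by simp, i3⟩ (by
          intro j hj υ hf _ ⟨j1, j2, j3, j4⟩
          rw [l1.reg_M] at hj
          have l2 := (l1.of_writes hf rfl).set j (r := .p) rfl
          have hr := run_respond l2 hn hm (by simpa using hj)
          simp only [State.set_reg, if_true, State.set_mem] at hr
          have l3 := l2.run (p := respond) rfl
          have m3 : (respond.run (υ.set .p j)).mem = υ.mem := run_mem_of_stores rfl _
          have p3 : (respond.run (υ.set .p j)).reg .p = j := by
            rw [run_reg_of_writes rfl]; simp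
          simp only [run_block_cons, run_block_nil]
          generalize respond.run (υ.set .p j) = υ' at *
          by_cases hok : (var Var.ok).Holds υ'
          · rw [run_ite_of_holds hok, run_skip, m3]
            refine ⟨j1, j2, fun p hp hw => ?_, j4⟩
            rcases Nat.lt_succ_iff_lt_or_eq.mp hp with hp | rfl
            · exact j3 p hp hw
            · refine ⟨(j2 p hj hw).coherent, fun x hx => ?_⟩
              obtain ⟨z, hz, hw'⟩ := hr.mp hok x hx
              exact ⟨z, hz, j2 _ (hsucc _ _ _ hx hz) hw'⟩
          · rw [run_ite_of_not_holds hok, run_store]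
            simp only [eval_add, eval_var, eval_lit, l3.reg_QH, p3]
            have hother : ∀ p, windows n (υ'.setMem (n * n + 2 + n * n * n + j) 0).mem p ↔
                p ≠ j ∧ windows n υ.mem p := by
              intro p
              rw [windows, windows, State.setMem_mem, m3]
              by_cases hpj : p = j
              · simp [hpj]
              · rw [if_neg (by omega)]; simp [hpj]
            refine ⟨fun p hp hw => (hother p).mpr ⟨?_, j1 p hp hw⟩,
              fun p hp hw => j2 p hp ((hother p).mp hw).2, fun p hp hw => ?_, fun b hb => ?_⟩
            · rintro rfl
              refine hok (hr.mpr fun x hx => ?_)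
              obtain ⟨z, hz, hw'⟩ := hW p hw x hx
              exact ⟨z, hz, j1 _ (hsucc _ _ _ hx hz) hw'⟩
            · obtain ⟨hp1, hp2⟩ := (hother p).mp hw
              exact j3 p (by omega) hp2
            · rw [State.setMem_mem, if_neg (by omega), m3, j4 b hb])
      rw [l1.reg_M] at inner
      exact ⟨inner.1, inner.2.2.1, inner.2.2.2⟩)
  rwa [h.reg_n] at key

theorem run_feasible {n m s : ℕ} {σ : State Var} (h : Layout n m s σ) :
    (feasible.run σ).reg .feas ≠ 0 ↔ ∃ p < (n * n * n) ^ m, windows n σ.mem p := by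
  have key := run_loop_induction (i := .p) (b := .M) (σ := σ.set .feas 0)
    (p := set .feas (add (var .feas) (load (add (var .QH) (var .p)))))
    (fun j τ => τ.reg .feas ≠ 0 ↔ ∃ p < j, windows n σ.mem p) (by simp) (by
      intro j _ τ hf hmem hI
      have l1 := (h.set 0 (r := .feas) rfl).of_writes hf rfl
      rw [Nat.exists_lt_succ_right, ← hI, windows]
      simp only [run_set, eval_add, eval_var, eval_load, State.set_reg, reduceCtorEq, if_false,
        if_true, State.set_mem, l1.reg_QH, hmem rfl]
      omega)
  rw [State.set_reg, if_neg (by decide), h.reg_M] at key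
  simpa only [feasible, run_block_cons, run_block_nil, run_set, eval_lit] using key

/-- The ordering `v` occurs only in the proof: the program does not read it, and its existence turns
a surviving window into a solution. -/
theorem run_test {n k : ℕ} {G : SimpleGraph (Fin n)} {s : Fin n} {v : Equiv.Perm (Fin n)}
    (hv : IsBandwidthOrdering G k v) {σ : State Var} (h : Layout n (2 * k + 1) s σ)
    (hA : ∀ e < n * n * n, calls n σ.mem e → Admissible G s e) :
    ((test.run σ).reg .feas ≠ 0 ↔ ∃ a, IsSolution n (calls n σ.mem) a) ∧
    ∀ b < n * n + 2 + n * n * n, (test.run σ).mem b = σ.mem b := by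
  have hn := s.pos
  have hm : 0 < 2 * k + 1 := by omega
  obtain ⟨a1, a2⟩ := run_initWindows h hn hm
  have l1 := h.run (p := initWindows) rfl
  have hrun : test.run σ = feasible.run (sweep.run (initWindows.run σ)) := by
    simp only [test, run_block_cons, run_block_nil]
  rw [hrun]
  have l2 := l1.run (p := sweep) rfl
  rw [run_feasible l2, run_mem_of_stores (p := feasible) rfl]
  refine ⟨⟨?_, ?_⟩, ?_⟩
  · rintro ⟨p, hp, hw⟩
    -- The restriction `e < n * n * n` is needed because the cells beyond the marks of calls hold
    -- marks of windows, about which `hA` says nothing.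
    set A : ℕ → Prop := fun e => e < n * n * n ∧ calls n σ.mem e with hAdef
    have b := run_sweep l1 hn hm (A := A) (W := fun _ => False) (fun p hp => by
      rw [a1 p hp]
      exact Coherent.congr hn fun e he => by simp [hAdef, he]) (fun _ h => h.elim)
      (fun _ h => h.elim)
    obtain ⟨a, ha⟩ := exists_solution_of_survives_of_bandwidth hv (fun e he => hA e he.1 he.2)
      (b.2.1 p hp hw)
    exact ⟨a, ha.mono fun x hx => (ha.mem x hx).2⟩
  · rintro ⟨a, ha⟩
    -- The windows of the solution are closed under responses, so their marks outlast all passes.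
    obtain ⟨b, -, -⟩ := run_sweep l1 hn hm (W := IsWindow n (2 * k + 1) a) a1
      (fun p hp => hp.coherent ha hm) (fun p hp x hx => hp.shift ha hm hx)
    obtain ⟨p, hp, hw⟩ := exists_isWindow (2 * k + 1) ha hn
    exact ⟨p, hp, b p hp hw⟩
  · intro b hb
    have c := run_sweep l1 hn hm (W := fun _ => False) a1 (fun _ h => h.elim) (fun _ h => h.elim)
    rw [c.2.2 b hb, a2 b hb]

/-! ### Marking the admissible calls and eliminating superfluous ones. -/

/-- The test whether the decoded call is admissible; `row = x * n`. -/
def admissibleExpr : Expr Var :=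
  .or (.and (.eq (var .x) (var .s)) (.and (.eq (var .y) (var .s)) (.not (var .t))))
    (.and (.not (.eq (var .x) (var .s))) (.and (var .t)
      (load (add (lit 2) (add (var .row) (var .y))))))

/-- Marks the admissible calls. -/
def initCalls : Stmt Var :=
  loop .e .N (block [decode, mulInto .row .x .n, ite admissibleExpr
    (store (add (var .QA) (var .e)) (lit 1)) (store (add (var .QA) (var .e)) (lit 0))])

/-- Removes the marks of calls as long as there is a solution, late calls first. -/
def eliminate : Stmt Var :=
  loop .i .N (block [set .g (sub (var .N) (add (var .i) (lit 1))),
    store (add (var .QA) (var .g)) (lit 0), test,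
    ite (var .feas) skip (store (add (var .QA) (var .g)) (lit 1))])

/-- The memory contains the adjacency matrix of `G`. -/
def HoldsGraph {n : ℕ} (G : SimpleGraph (Fin n)) (mem : ℕ → ℕ) : Prop :=
  ∀ x y : Fin n, mem (2 + (x * n + y)) ≠ 0 ↔ G.Adj x y

/-- The marks start at cell `n * n + 2`, where an ordering in the input would be stored; it is no
longer needed. The invariant only has to protect the cells below, which contain the adjacency
matrix. -/
theorem run_initCalls {n m : ℕ} {G : SimpleGraph (Fin n)} {s : Fin n} {σ : State Var}
    (h : Layout n m s σ) (hm : 0 < m) (hG : HoldsGraph G σ.mem) :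
    ∀ e < n * n * n, calls n (initCalls.run σ).mem e ↔ Admissible G s e := by
  have hn := s.pos
  have key := run_loop_induction (i := .e) (b := .N) (σ := σ)
    (p := block [decode, mulInto .row .x .n, ite admissibleExpr
      (store (add (var .QA) (var .e)) (lit 1)) (store (add (var .QA) (var .e)) (lit 0))])
    (fun j τ => (∀ e < j, calls n τ.mem e ↔ Admissible G s e) ∧
      ∀ b < n * n + 2, τ.mem b = σ.mem b) (by simp) (by
      intro j hj τ hf _ ⟨h1, h2⟩
      rw [h.reg_N] at hj
      have l1 := (h.of_writes hf rfl).set j (r := .e) rfl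
      obtain ⟨d1, d2, d3, -⟩ := run_decode l1 hn
        (by simpa using hj.le.trans (Nat.le_self_pow hm.ne' _))
      simp only [State.set_reg, if_true] at d1 d2 d3
      have l2 := l1.run (p := decode) rfl
      have m2 : (decode.run (τ.set .e j)).mem = τ.mem := run_mem_of_stores rfl _
      have e2 : (decode.run (τ.set .e j)).reg .e = j := by rw [run_reg_of_writes rfl]; simp
      simp only [run_block_cons, run_block_nil]
      generalize decode.run (τ.set .e j) = τ₁ at *
      have c0 := run_mulInto (d := .row) (a := .x) (b := .n) (by decide) (by decide) (by decide)
        (by decide) τ₁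
      have c1 := run_reg_of_writes (p := mulInto .row .x .n) (r := .x) rfl τ₁
      have c2 := run_reg_of_writes (p := mulInto .row .x .n) (r := .y) rfl τ₁
      have c3 := run_reg_of_writes (p := mulInto .row .x .n) (r := .t) rfl τ₁
      have c4 := run_reg_of_writes (p := mulInto .row .x .n) (r := .e) rfl τ₁
      have m3 := run_mem_of_stores (p := mulInto .row .x .n) rfl τ₁
      have l3 := l2.run (p := mulInto .row .x .n) rfl
      rw [d1, l2.reg_n] at c0
      rw [d1] at c1
      rw [d2] at c2
      rw [d3] at c3
      rw [e2] at c4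
      rw [m2] at m3
      generalize (mulInto .row .x .n).run τ₁ = τ₂ at *
      have hx := vertexOf_lt hn j
      have hy := callerOf_lt hn j
      have hadm : admissibleExpr.Holds τ₂ ↔ Admissible G s j := by
        have hadj := hG ⟨_, hx⟩ ⟨_, hy⟩
        have hlt : 2 + (vertexOf n j * n + callerOf n j) < n * n + 2 := by
          have : (vertexOf n j + 1) * n ≤ n * n := Nat.mul_le_mul_right n hx
          rw [Nat.add_mul] at this
          omega
        rw [← h2 _ hlt] at hadj
        simp only [admissibleExpr, holds_or, holds_and, holds_not, holds_eq, holds_load, holds_var,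
          eval_var, eval_add, eval_lit, c0, c1, c2, c3, l3.reg_s, m3, hadj, Admissible]
        simp [hx, hy]
      have hset : ∀ b, (b ≠ 0 ↔ Admissible G s j) →
          (∀ e < j + 1, calls n (τ₂.setMem (n * n + 2 + j) b).mem e ↔ Admissible G s e) ∧
          ∀ c < n * n + 2, (τ₂.setMem (n * n + 2 + j) b).mem c = σ.mem c := by
        intro b hb
        refine ⟨fun e he => ?_, fun c hc => ?_⟩
        · rw [calls, State.setMem_mem]
          by_cases hej : e = j
          · subst hej; simpa using hb
          · rw [if_neg (by omega), m3]
            exact h1 e (by omega)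
        · rw [State.setMem_mem, if_neg (by omega), m3, h2 c hc]
      by_cases hA : admissibleExpr.Holds τ₂
      · rw [run_ite_of_holds hA, run_store]
        simp only [eval_add, eval_var, eval_lit, l3.reg_QA, c4]
        exact hset 1 (by simpa using hadm.mp hA)
      · rw [run_ite_of_not_holds hA, run_store]
        simp only [eval_add, eval_var, eval_lit, l3.reg_QA, c4]
        exact hset 0 (by simpa using hadm.not.mp hA))
  rw [h.reg_N] at key
  exact key.1

theorem IsSolution.of_imp {n : ℕ} {A A' : ℕ → Prop} {a : ℕ → ℕ} (h : IsSolution n A a)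
    (hA : ∀ e < n * n * n, A e → A' e) : IsSolution n A' a :=
  h.mono fun x hx => hA _ (h.lt x hx) (h.mem x hx)

/-- A call is kept only if every solution among the calls marked at that moment uses it, and at that
moment all smaller admissible calls are still marked. Hence the marks that remain at the end all
belong to one solution `a`, and no solution can consist of calls smaller than some `a x`: the
largest call of `a` is least possible. -/
theorem run_eliminate {n k : ℕ} {G : SimpleGraph (Fin n)} {s : Fin n} {v : Equiv.Perm (Fin n)}
    (hv : IsBandwidthOrdering G k v) {σ : State Var} (h : Layout n (2 * k + 1) s σ)
    (hA : ∀ e < n * n * n, calls n σ.mem e ↔ Admissible G s e)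
    (hsol : ∃ a, IsSolution n (Admissible G s) a) :
    ∃ a, IsSolution n (Admissible G s) a ∧
      (∀ e < n * n * n, calls n (eliminate.run σ).mem e ↔ ∃ x < n, a x = e) ∧
      ∀ b, IsSolution n (Admissible G s) b → ∀ x < n, ∃ y < n, a x ≤ b y := by
  have key := run_loop_induction (i := .i) (b := .N) (σ := σ)
    (p := block [set .g (sub (var .N) (add (var .i) (lit 1))),
      store (add (var .QA) (var .g)) (lit 0), test,
      ite (var .feas) skip (store (add (var .QA) (var .g)) (lit 1))])
    -- The calls `e` with `n * n * n ≤ e + i` have been tried. The last clause records why a tried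
    -- call was kept: no solution avoids `e` while using only calls that are smaller than `e` or
    -- still marked. Later deletions shrink the marked set and so preserve it.
    (fun i τ => (∀ e < n * n * n, e + i < n * n * n → (calls n τ.mem e ↔ Admissible G s e)) ∧
      (∀ e < n * n * n, calls n τ.mem e → Admissible G s e) ∧
      (∃ a, IsSolution n (calls n τ.mem) a) ∧
      ∀ e < n * n * n, n * n * n ≤ e + i → calls n τ.mem e → ∀ b, IsSolution n (Admissible G s) b →
        ¬ ∀ x < n, b x ≠ e ∧ (b x < e ∨ calls n τ.mem (b x)))
    ⟨fun e he _ => hA e he, fun e he => (hA e he).mp, by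
      obtain ⟨a, ha⟩ := hsol
      exact ⟨a, ha.of_imp fun e he => (hA e he).mpr⟩, fun e he he' => absurd he (by omega)⟩ (by
      intro i hi τ hf _ ⟨i1, i2, i3, i4⟩
      rw [h.reg_N] at hi
      have l1 := (h.of_writes hf rfl).set i (r := .i) rfl
      have l2 := l1.set (n * n * n - (i + 1)) (r := .g) rfl
      have l3 := l2.setMem (n * n + 2 + (n * n * n - (i + 1))) 0
      obtain ⟨g, hg, hgi⟩ : ∃ g, n * n * n - (i + 1) = g ∧ g + (i + 1) = n * n * n :=
        ⟨_, rfl, by omega⟩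
      rw [hg] at l2 l3
      have hc1 : ∀ e, calls n (((τ.set .i i).set .g g).setMem (n * n + 2 + g) 0).mem e ↔
          e ≠ g ∧ calls n τ.mem e := by
        intro e
        rw [calls, calls, State.setMem_mem]
        by_cases heg : e = g
        · simp [heg]
        · rw [if_neg (by omega)]; simp [heg]
      obtain ⟨t1, t2⟩ := run_test hv l3 (fun e he hc => i2 e he ((hc1 e).mp hc).2)
      have l4 := l3.run (p := test) rfl
      have g4 : (test.run (((τ.set .i i).set .g g).setMem (n * n + 2 + g) 0)).reg .g = g := by
        rw [run_reg_of_writes rfl]; simp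
      simp only [run_block_cons, run_block_nil, run_set, run_store, eval_sub, eval_add, eval_var,
        eval_lit, l1.reg_N, l2.reg_QA, State.set_reg, reduceCtorEq, if_false, if_true, hg]
      have hc2 : ∀ e < n * n * n,
          calls n (test.run (((τ.set .i i).set .g g).setMem (n * n + 2 + g) 0)).mem e ↔
          e ≠ g ∧ calls n τ.mem e := by
        intro e he
        rw [← hc1, calls, t2 _ (by omega), calls]
      generalize test.run (((τ.set .i i).set .g g).setMem (n * n + 2 + g) 0) = υ at *
      by_cases hfeas : (var Var.feas).Holds υ
      · rw [run_ite_of_holds hfeas, run_skip]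
        obtain ⟨a, ha⟩ := t1.mp hfeas
        refine ⟨fun e he hei => ?_, fun e he hc => i2 e he ((hc2 e he).mp hc).2,
          ⟨a, ha.of_imp fun e he hc => (hc2 e he).mpr ((hc1 e).mp hc)⟩, fun e he hei hc b hb hbe => ?_⟩
        · rw [hc2 e he, ← i1 e he (by omega)]
          exact and_iff_right (by omega)
        · obtain ⟨h1, h2⟩ := (hc2 e he).mp hc
          refine i4 e he (by omega) h2 b hb fun x hx => ⟨(hbe x hx).1, ?_⟩
          exact (hbe x hx).2.imp_right fun h => ((hc2 _ (hb.lt x hx)).mp h).2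
      · rw [run_ite_of_not_holds hfeas, run_store]
        simp only [eval_add, eval_var, eval_lit, l4.reg_QA, g4]
        have hgA : calls n τ.mem g := by
          by_contra hng
          obtain ⟨a, ha⟩ := i3
          refine hfeas (t1.mpr ⟨a, ha.of_imp fun e he hc => (hc1 e).mpr ⟨?_, hc⟩⟩)
          rintro rfl
          exact hng hc
        have hc3 : ∀ e < n * n * n, calls n (υ.setMem (n * n + 2 + g) 1).mem e ↔
            calls n τ.mem e := by
          intro e he
          rw [calls, State.setMem_mem]
          by_cases heg : e = g
          · subst heg; simpa using hgA
          · rw [if_neg (by omega)]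
            exact (hc2 e he).trans (and_iff_right heg)
        refine ⟨fun e he hei => (hc3 e he).trans (i1 e he (by omega)),
          fun e he hc => i2 e he ((hc3 e he).mp hc), ?_, fun e he hei hc b hb hbe => ?_⟩
        · obtain ⟨a, ha⟩ := i3
          exact ⟨a, ha.of_imp fun e he => (hc3 e he).mpr⟩
        · have hbe' : ∀ x < n, b x ≠ e ∧ (b x < e ∨ calls n τ.mem (b x)) := fun x hx =>
            ⟨(hbe x hx).1, (hbe x hx).2.imp_right (hc3 _ (hb.lt x hx)).mp⟩
          by_cases heg : e = g
          -- Smaller calls have not been tried yet, so a solution of the excluded kind would have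
          -- made the test succeed.
          · subst heg
            refine hfeas (t1.mpr ⟨b, hb.mono fun x hx => (hc1 _).mpr ⟨(hbe' x hx).1, ?_⟩⟩)
            rcases (hbe' x hx).2 with h1 | h1
            · exact (i1 _ (hb.lt x hx) (by omega)).mpr (hb.mem x hx)
            · exact h1
          · exact i4 e he (by omega) ((hc3 e he).mp hc) b hb hbe')
  rw [h.reg_N] at key
  change _ ∧ _ ∧ _ ∧ _ at key
  obtain ⟨-, k2, ⟨a, ha⟩, k4⟩ := key
  have ha' : IsSolution n (Admissible G s) a := ha.of_imp k2
  refine ⟨a, ha', fun e he => ⟨fun hc => ?_, ?_⟩, fun b hb x hx => ?_⟩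
  · by_contra hne
    push Not at hne
    -- A marked call outside `a` is impossible, as `a` itself would be a marked solution avoiding
    -- it.
    exact k4 e he (by omega) hc a ha' fun x hx => ⟨hne x hx, .inr (ha.mem x hx)⟩
  · rintro ⟨x, hx, rfl⟩
    exact ha.mem x hx
  · by_contra hne
    push Not at hne
    -- A solution all of whose calls are smaller than `a x` is excluded by the first alternative of
    -- the last clause.
    exact k4 (a x) (ha.lt x hx) (by omega) (ha.mem x hx) b hb fun y hy =>
      ⟨(hne y hy).ne, .inl (hne y hy)⟩

/-! ### Writing the scheme to the output cells. -/

/-- Writes the decoded call `e` into the table. -/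
def outputCall : Stmt Var :=
  ite (load (add (var .QA) (var .e))) (block [decode, ite (var .t)
    -- A call at time `t` is made in round `t - 1`, so its table index is `w - n = (t - 1) * n + y`.
    (block [store (add (lit 1) (sub (var .w) (var .n))) (add (var .x) (lit 1)),
      -- With truncated subtraction, `r + (t - r)` is the maximum of `r` and `t`.
      set .r (add (var .r) (sub (var .t) (var .r)))]) skip]) skip

/-- Writes the marked calls and the number of rounds to the output cells. -/
def output : Stmt Var :=
  block [loop .e .nn (store (add (lit 1) (var .e)) (lit 0)), set .r (lit 0),
    loop .e .N outputCall, store (lit 0) (var .r)]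

/-- Different calls of a scheme never compete for a table cell, since the cell determines caller and
time. Positive times are needed because the subtraction truncates. -/
theorem eq_of_div_sub_eq {n e f : ℕ} (h : Compatible n e f) (he : timeOf n e ≠ 0)
    (hf : timeOf n f ≠ 0) (hef : e / n - n = f / n - n) : e = f := by
  have hle : ∀ {e}, timeOf n e ≠ 0 → n ≤ e / n := fun {e} he => by
    by_contra hlt
    exact he (Nat.div_eq_of_lt (not_le.mp hlt))
  have h1 : e / n = f / n := by
    have := hle he
    have := hle hf
    omega
  rcases h with h | ⟨-, -, -, h⟩
  · exact h
  · exact absurd (by rw [timeOf, timeOf, h1]) (h (by rw [callerOf, callerOf, h1]))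

/-- The output overwrites cells `0` to `n * n`, which held part of the input. The marks of calls
start at `n * n + 2` and stay readable throughout. -/
theorem run_output {n m s : ℕ} {σ : State Var} (h : Layout n m s σ) (hn : 0 < n) (hm : 0 < m)
    {C : ℕ → Prop} (hC : ∀ e < n * n * n, calls n σ.mem e ↔ C e)
    (hcomp : ∀ e f, C e → C f → Compatible n e f) :
    (∀ e < n * n * n, C e → timeOf n e ≤ (output.run σ).mem 0) ∧
    ((output.run σ).mem 0 = 0 ∨ ∃ e < n * n * n, C e ∧ timeOf n e = (output.run σ).mem 0) ∧
    ∀ b < n * n, (∀ e < n * n * n, C e → timeOf n e ≠ 0 → e / n - n = b →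
        (output.run σ).mem (1 + b) = vertexOf n e + 1) ∧
      ((∀ e < n * n * n, C e → timeOf n e ≠ 0 → e / n - n ≠ b) →
        (output.run σ).mem (1 + b) = 0) := by
  have z := run_loop_induction (i := .e) (b := .nn) (σ := σ)
    (p := store (add (lit 1) (var .e)) (lit 0))
    (fun j τ => (∀ b < j, τ.mem (1 + b) = 0) ∧ ∀ b, n * n + 2 ≤ b → τ.mem b = σ.mem b)
    (by simp) (by
      intro j hj τ _ _ ⟨h1, h2⟩
      rw [h.reg_nn] at hj
      simp only [run_store, eval_add, eval_lit, eval_var, State.set_reg, if_true]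
      refine ⟨fun b hb => ?_, fun b hb => ?_⟩
      · rw [State.setMem_mem]
        by_cases hbj : b = j
        · simp [hbj]
        · rw [if_neg (by omega), State.set_mem, h1 b (by omega)]
      · rw [State.setMem_mem, if_neg (by omega), State.set_mem, h2 b hb])
  rw [h.reg_nn] at z
  have l1 := h.run (p := loop .e .nn (store (add (lit 1) (var .e)) (lit 0))) rfl
  have hrun : output.run σ = (block [set .r (lit 0), loop .e .N outputCall,
      store (lit 0) (var .r)]).run ((loop .e .nn (store (add (lit 1) (var .e)) (lit 0))).run σ) := by
    simp only [output, run_block_cons]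
  rw [hrun]
  generalize Stmt.run (ν := Var) (loop Var.e Var.nn _) _ = σ₁ at *
  obtain ⟨z1, z2⟩ := z
  have l2 := l1.set 0 (r := .r) rfl
  simp only [run_block_cons, run_block_nil, run_set, eval_lit]
  have key := run_loop_induction (i := .e) (b := .N) (σ := σ₁.set .r 0) (p := outputCall)
    (fun j τ => ((∀ e < j, C e → timeOf n e ≤ τ.reg .r) ∧
      (τ.reg .r = 0 ∨ ∃ e < j, C e ∧ timeOf n e = τ.reg .r)) ∧
      (∀ b < n * n, (∀ e < j, C e → timeOf n e ≠ 0 → e / n - n = b →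
        τ.mem (1 + b) = vertexOf n e + 1) ∧
        ((∀ e < j, C e → timeOf n e ≠ 0 → e / n - n ≠ b) → τ.mem (1 + b) = 0)) ∧
      ∀ b, n * n + 2 ≤ b → τ.mem b = σ.mem b)
    ⟨by simp, fun b hb => ⟨by simp, fun _ => z1 b hb⟩, z2⟩ (by
      intro j hj τ hf _ ⟨⟨i1, i2⟩, i3, i4⟩
      rw [l2.reg_N] at hj
      have l3 := (l2.of_writes hf rfl).set j (r := .e) rfl
      have hcall : (load (add (var .QA) (var .e))).Holds (τ.set .e j) ↔ C j := by
        simp only [holds_load, eval_add, eval_var, l3.reg_QA]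
        simp only [State.set_reg, if_true, State.set_mem]
        rw [i4 _ (by omega)]
        exact hC j hj
      -- Common treatment of the two cases in which nothing is written: an unmarked call, and a call
      -- of time `0`.
      have hskip : ∀ υ : State Var, υ.mem = τ.mem → υ.reg .r = τ.reg .r →
          (C j → timeOf n j = 0) →
          (((∀ e < j + 1, C e → timeOf n e ≤ υ.reg .r) ∧
          (υ.reg .r = 0 ∨ ∃ e < j + 1, C e ∧ timeOf n e = υ.reg .r)) ∧
          (∀ b < n * n, (∀ e < j + 1, C e → timeOf n e ≠ 0 → e / n - n = b →
            υ.mem (1 + b) = vertexOf n e + 1) ∧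
            ((∀ e < j + 1, C e → timeOf n e ≠ 0 → e / n - n ≠ b) → υ.mem (1 + b) = 0)) ∧
          ∀ b, n * n + 2 ≤ b → υ.mem b = σ.mem b) := by
        intro υ hm hr hj0
        rw [hm, hr]
        refine ⟨⟨fun e he hc => ?_, i2.imp_right ?_⟩, fun b hb => ⟨fun e he hc ht heb => ?_,
          fun hall => (i3 b hb).2 fun e he => hall e (by omega)⟩, i4⟩
        · rcases Nat.lt_succ_iff_lt_or_eq.mp he with he | rfl
          · exact i1 e he hc
          · rw [hj0 hc]; exact Nat.zero_le _
        · rintro ⟨e, he, h⟩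
          exact ⟨e, by omega, h⟩
        · rcases Nat.lt_succ_iff_lt_or_eq.mp he with he | rfl
          · exact (i3 b hb).1 e he hc ht heb
          · exact absurd (hj0 hc) ht
      rw [outputCall]
      by_cases hCj : C j
      swap
      · rw [run_ite_of_not_holds (hcall.not.mpr hCj), run_skip]
        exact hskip _ rfl (by simp) fun hc => absurd hc hCj
      rw [run_ite_of_holds (hcall.mpr hCj)]
      obtain ⟨d1, -, d3, d4⟩ := run_decode l3 hn
        (by simpa using hj.le.trans (Nat.le_self_pow hm.ne' _))
      simp only [State.set_reg, if_true] at d1 d3 d4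
      have r4 : (decode.run (τ.set .e j)).reg .r = τ.reg .r := by
        rw [run_reg_of_writes rfl]; simp
      have m4 : (decode.run (τ.set .e j)).mem = τ.mem := run_mem_of_stores rfl _
      have l4 := l3.run (p := decode) rfl
      simp only [run_block_cons, run_block_nil]
      generalize decode.run (τ.set .e j) = υ at *
      by_cases ht : timeOf n j = 0
      · rw [run_ite_of_not_holds (by simp [d3, ht]), run_skip]
        exact hskip υ m4 r4 fun _ => ht
      rw [run_ite_of_holds (by simpa [d3] using ht)]
      simp only [run_block_cons, run_block_nil, run_store, run_set, eval_add, eval_sub, eval_var,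
        eval_lit, State.setMem_reg, State.set_reg, if_true, State.set_mem, l4.reg_n, d1, d3, d4, r4]
      have hw : j / n < n * n := Nat.div_lt_of_lt_mul (by rwa [Nat.mul_comm] at hj)
      refine ⟨⟨fun e he hc => ?_, ?_⟩, fun b hb => ⟨fun e he hc hte heb => ?_, fun hall => ?_⟩,
        fun b hb => ?_⟩
      · rcases Nat.lt_succ_iff_lt_or_eq.mp he with he | rfl
        · have := i1 e he hc
          omega
        · omega
      · by_cases hlt : τ.reg .r ≤ timeOf n j
        · exact .inr ⟨j, by omega, hCj, by omega⟩
        · rw [show τ.reg .r + (timeOf n j - τ.reg .r) = τ.reg .r by omega]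
          refine i2.imp_right ?_
          rintro ⟨e, he, h⟩
          exact ⟨e, by omega, h⟩
      · rw [State.setMem_mem]
        by_cases hbj : b = j / n - n
        · rw [if_pos (by omega), eq_of_div_sub_eq (hcomp e j hc hCj) hte ht (by omega)]
        · rw [if_neg (by omega), m4]
          refine (i3 b hb).1 e ?_ hc hte heb
          rcases Nat.lt_succ_iff_lt_or_eq.mp he with he | rfl
          · exact he
          · exact absurd heb.symm hbj
      · have := hall j (by omega) hCj ht
        rw [State.setMem_mem, if_neg (by omega), m4]
        exact (i3 b hb).2 fun e he => hall e (by omega)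
      · rw [State.setMem_mem, if_neg (by omega), m4, i4 b hb])
  rw [l2.reg_N] at key
  generalize Stmt.run (ν := Var) (loop Var.e Var.N _) _ = υ at *
  obtain ⟨⟨k1, k2⟩, k3, -⟩ := key
  simp only [run_store, eval_lit, eval_var]
  have h0 : (υ.setMem 0 (υ.reg .r)).mem 0 = υ.reg .r := by simp
  rw [h0]
  refine ⟨k1, k2, fun b hb => ?_⟩
  rw [State.setMem_mem, if_neg (by omega)]
  exact k3 b hb

/-- The time of a call is monotone in its code, being obtained by dividing twice by `n`. So a
solution with least largest code also has least largest time. -/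
theorem holdsOptimalScheme_of_solution {n : ℕ} {G : SimpleGraph (Fin n)} {s : Fin n} {a : ℕ → ℕ}
    (ha : IsSolution n (Admissible G s) a)
    (hmin : ∀ b, IsSolution n (Admissible G s) b → ∀ x < n, ∃ y < n, a x ≤ b y)
    (hG : G.Connected) {mem : ℕ → ℕ} (h1 : ∀ x < n, timeOf n (a x) ≤ mem 0)
    (h2 : mem 0 = 0 ∨ ∃ x < n, timeOf n (a x) = mem 0)
    (h3 : ∀ b < n * n, (∀ x < n, timeOf n (a x) ≠ 0 → a x / n - n = b → mem (1 + b) = x + 1) ∧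
      ((∀ x < n, timeOf n (a x) ≠ 0 → a x / n - n ≠ b) → mem (1 + b) = 0)) :
    HoldsOptimalScheme G s mem := by
  have hn := s.pos
  have hopt : mem 0 = broadcastTime G s := by
    refine le_antisymm ?_ (broadcastTime_le ha h1)
    rcases h2 with h2 | ⟨x, hx, h2⟩
    · omega
    · obtain ⟨b, hb, hbt⟩ := broadcastTime_spec hG s
      obtain ⟨y, hy, hxy⟩ := hmin b hb x hx
      rw [← h2]
      exact (Nat.div_le_div_right (Nat.div_le_div_right hxy)).trans (hbt y hy)
  have ht := ha.isTiming
  refine ⟨hopt, _, hopt ▸ ht.isScheme fun x => h1 x x.2, fun i hi u => ?_⟩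
  rw [← hopt] at hi
  -- The number of rounds is `0` or the time of some call, hence below `n`; all rows of the table
  -- lie within the `n * n` cells controlled by `h3`.
  have hin : i + 1 < n := by
    rcases h2 with h2 | ⟨x, hx, h2⟩
    · omega
    · have := timeOf_lt (ha.lt x hx)
      omega
  have hb : i * n + u < n * n := by
    have : (i + 1) * n ≤ n * n := Nat.mul_le_mul_right n (by omega)
    rw [Nat.add_mul] at this
    omega
  obtain ⟨c1, c2⟩ := h3 _ hb
  rw [Nat.add_assoc]
  have hdiv : ∀ e, e / n = timeOf n e * n + callerOf n e := fun e => by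
    rw [timeOf, callerOf, Nat.div_add_mod']
  rcases hcall : callsOf s (fun x : Fin n => timeOf n (a x))
    (fun x => ⟨callerOf n (a x), callerOf_lt s.pos _⟩) i u with _ | x
  · refine c2 fun x hx htx hab => ?_
    have hs : (⟨x, hx⟩ : Fin n) ≠ s := by
      rintro rfl
      exact htx ht.source
    have hy := callerOf_lt hn (a x)
    obtain ⟨t, hte⟩ := Nat.exists_eq_succ_of_ne_zero htx
    rw [hdiv, hte, Nat.succ_mul] at hab
    have hab' : t * n + callerOf n (a x) = i * n + u := by omega
    have e1 := congrArg (· % n) hab'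
    have e2 := congrArg (· / n) hab'
    simp only [Nat.add_comm (_ * n), Nat.add_mul_mod_self_right, Nat.mod_eq_of_lt hy,
      Nat.mod_eq_of_lt u.2, Nat.add_mul_div_right _ _ hn, Nat.div_eq_of_lt hy,
      Nat.div_eq_of_lt u.2, zero_add] at e1 e2
    have : callsOf s (fun x : Fin n => timeOf n (a x))
      (fun x => ⟨callerOf n (a x), callerOf_lt s.pos _⟩) i u = some ⟨x, hx⟩ :=
      ht.callsOf_eq_some.mpr ⟨hs, Fin.ext e1, by rw [hte, e2]⟩
    rw [this] at hcall
    cases hcall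
  · obtain ⟨-, d2, d3⟩ := ht.callsOf_eq_some.mp hcall
    refine c1 x x.2 (by omega) ?_
    rw [hdiv, d3, ← d2, Nat.add_mul]
    simp only
    omega

/-- The part of the program that runs when all constants are known. -/
def main : Stmt Var := block [initCalls, eliminate, output]

theorem run_main {n k : ℕ} {G : SimpleGraph (Fin n)} {s : Fin n} {v : Equiv.Perm (Fin n)}
    (hG : G.Connected) (hv : IsBandwidthOrdering G k v) {σ : State Var}
    (h : Layout n (2 * k + 1) s σ) (hmem : HoldsGraph G σ.mem) :
    HoldsOptimalScheme G s (main.run σ).mem := by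
  have hn := s.pos
  have l1 := h.run (p := initCalls) rfl
  obtain ⟨b, hb, -⟩ := broadcastTime_spec hG s
  obtain ⟨a, ha, hC, hmin⟩ := run_eliminate hv l1 (run_initCalls h (by omega) hmem) ⟨b, hb⟩
  have l2 := l1.run (p := eliminate) rfl
  obtain ⟨o1, o2, o3⟩ := run_output l2 hn (by omega) hC (by
    rintro e f ⟨x, hx, rfl⟩ ⟨y, hy, rfl⟩
    exact ha.compatible x hx y hy)
  simp only [main, run_block_cons, run_block_nil]
  refine holdsOptimalScheme_of_solution ha hmin hG (fun x hx => o1 _ (ha.lt x hx) ⟨x, hx, rfl⟩)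
    (o2.imp_right ?_) fun c hc => ⟨fun x hx ht hac => ?_, fun hall => (o3 c hc).2 ?_⟩
  · rintro ⟨_, -, ⟨x, hx, rfl⟩, h⟩
    exact ⟨x, hx, h⟩
  · rw [(o3 c hc).1 _ (ha.lt x hx) ⟨x, hx, rfl⟩ ht hac, ha.vertex x hx]
  · rintro _ - ⟨x, hx, rfl⟩
    exact hall x hx

/-! ### Initialization of the constants, and reading the bandwidth of the given ordering. -/

/-- Reads `n` and `s`. -/
def readHeader : Stmt Var := block [set .n (load (lit 0)), set .s (load (lit 1))]

/-- Computes the constants that depend only on `n`. -/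
def setLayout : Stmt Var :=
  block [mulInto .nn .n .n, mulInto .N .nn .n, set .QA (add (var .nn) (lit 2)),
    set .QH (add (var .QA) (var .N))]

/-- Computes `M = N ^ m`. -/
def setPower : Stmt Var :=
  block [set .M (lit 1), loop .i .m (block [mulInto .row .M .N, set .M (var .row)])]

/-- The program, for a program `setWidth` that computes the length `m` of the windows. -/
def program (setWidth : Stmt Var) : Stmt Var :=
  block [readHeader, setLayout, setWidth, setPower, main]

/-- Computes the bandwidth `k` of the ordering in the input, and `m = 2 * k + 1`. -/
def readWidth : Stmt Var :=
  block [set .k (lit 0),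
    loop .i .n (block [set .u (load (add (var .QA) (var .i))), mulInto .row .u .n,
      loop .j .n (block [set .v (load (add (var .QA) (var .j))),
        ite (load (add (lit 2) (add (var .row) (var .v))))
          (set .k (add (var .k) (sub (sub (var .j) (var .i)) (var .k)))) skip])]),
    set .m (add (add (var .k) (var .k)) (lit 1))]

/-- The memory contains the ordering `v`. -/
def HoldsOrdering {n : ℕ} (v : Equiv.Perm (Fin n)) (mem : ℕ → ℕ) : Prop :=
  ∀ i : Fin n, mem (n * n + 2 + i) = v i

theorem run_setLayout {σ : State Var} {n : ℕ} (h : σ.reg .n = n) :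
    (setLayout.run σ).reg .nn = n * n ∧ (setLayout.run σ).reg .N = n * n * n ∧
      (setLayout.run σ).reg .QA = n * n + 2 ∧
      (setLayout.run σ).reg .QH = n * n + 2 + n * n * n := by
  have a1 := run_mulInto (d := .nn) (a := .n) (b := .n) (by decide) (by decide) (by decide)
    (by decide) σ
  have a2 := run_reg_of_writes (p := mulInto .nn .n .n) (r := .n) rfl σ
  simp only [setLayout, run_block_cons, run_block_nil, run_set, eval_add, eval_var, eval_lit]
  generalize (mulInto .nn .n .n).run σ = σ₁ at *
  have b1 := run_mulInto (d := .N) (a := .nn) (b := .n) (by decide) (by decide) (by decide)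
    (by decide) σ₁
  have b2 := run_reg_of_writes (p := mulInto .N .nn .n) (r := .nn) rfl σ₁
  generalize (mulInto .N .nn .n).run σ₁ = σ₂ at *
  rw [h] at a1 a2
  rw [a1, a2] at b1
  rw [a1] at b2
  simp [b1, b2]

theorem run_setPower (σ : State Var) :
    (setPower.run σ).reg .M = σ.reg .N ^ σ.reg .m := by
  have key := run_loop_induction (i := .i) (b := .m) (σ := σ.set .M 1)
    (p := block [mulInto .row .M .N, set .M (var .row)])
    (fun j τ => τ.reg .M = σ.reg .N ^ j) (by simp) (by
      intro j _ τ hf _ hI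
      have hN := hf .N rfl
      have := run_mulInto (d := .row) (a := .M) (b := .N) (by decide) (by decide) (by decide)
        (by decide) (τ.set .i j)
      simp only [State.set_reg, reduceCtorEq, if_false] at this hN
      simp only [run_block_cons, run_block_nil, run_set, eval_var, State.set_reg, if_true, this, hI,
        hN, pow_succ])
  simpa [setPower] using key

/-- Adjacency is symmetric, so truncated differences over ordered pairs suffice; these are what the
machine can compute. -/
theorem isBandwidthOrdering_iff {n : ℕ} {G : SimpleGraph (Fin n)} {k : ℕ}
    {v : Equiv.Perm (Fin n)} :
    IsBandwidthOrdering G k v ↔ ∀ i j : Fin n, G.Adj (v i) (v j) → (j : ℕ) - i ≤ k := by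
  refine ⟨fun h i j hij => ?_, fun h i j hij => ?_⟩
  · have := abs_le.mp (h i j hij)
    omega
  · have h1 := h i j hij
    have h2 := h j i hij.symm
    rw [abs_le]
    omega

/-- The number `k` is not part of the input. The program takes the maximum of `j - i` over all
edges, which is the least `k` valid for the ordering. -/
theorem run_readWidth {n : ℕ} {G : SimpleGraph (Fin n)} {v : Equiv.Perm (Fin n)} {σ : State Var}
    (hn : σ.reg .n = n) (hQA : σ.reg .QA = n * n + 2) (hG : HoldsGraph G σ.mem)
    (hv : HoldsOrdering v σ.mem) :
    ∃ k, (readWidth.run σ).reg .m = 2 * k + 1 ∧ IsBandwidthOrdering G k v ∧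
      ∀ k', IsBandwidthOrdering G k' v → k ≤ k' := by
  have key := run_loop_induction (i := .i) (b := .n) (σ := σ.set .k 0)
    (p := block [set .u (load (add (var .QA) (var .i))), mulInto .row .u .n,
      loop .j .n (block [set .v (load (add (var .QA) (var .j))),
        ite (load (add (lit 2) (add (var .row) (var .v))))
          (set .k (add (var .k) (sub (sub (var .j) (var .i)) (var .k)))) skip])])
    (fun c τ => (∀ i j : Fin n, (i : ℕ) < c → G.Adj (v i) (v j) → (j : ℕ) - i ≤ τ.reg .k) ∧
      ∀ k', IsBandwidthOrdering G k' v → τ.reg .k ≤ k') (by simp) (by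
      intro i hi τ hf hmem ⟨h1, h2⟩
      have hmem := hmem rfl
      have f1 := hf .n rfl
      have f2 := hf .QA rfl
      simp only [State.set_reg, State.set_mem, reduceCtorEq, if_false, hn, hQA] at f1 f2 hmem hi
      simp only [run_block_cons, run_block_nil, run_set, eval_load, eval_add, eval_var,
        State.set_reg, State.set_mem, reduceCtorEq, if_false, if_true, f2, hmem, hv ⟨i, hi⟩]
      have a1 := run_mulInto (d := .row) (a := .u) (b := .n) (by decide) (by decide) (by decide)
        (by decide) ((τ.set .i i).set .u (v ⟨i, hi⟩))
      have a2 := run_reg_of_writes (p := mulInto .row .u .n) (r := .n) rfl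
        ((τ.set .i i).set .u (v ⟨i, hi⟩))
      have a3 := run_reg_of_writes (p := mulInto .row .u .n) (r := .QA) rfl
        ((τ.set .i i).set .u (v ⟨i, hi⟩))
      have a4 := run_reg_of_writes (p := mulInto .row .u .n) (r := .i) rfl
        ((τ.set .i i).set .u (v ⟨i, hi⟩))
      have a5 := run_reg_of_writes (p := mulInto .row .u .n) (r := .k) rfl
        ((τ.set .i i).set .u (v ⟨i, hi⟩))
      have a6 := run_mem_of_stores (p := mulInto .row .u .n) rfl
        ((τ.set .i i).set .u (v ⟨i, hi⟩))
      simp only [State.set_reg, State.set_mem, reduceCtorEq, if_false, if_true, f1, f2, hmem]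
        at a1 a2 a3 a4 a5 a6
      generalize (mulInto .row .u .n).run _ = υ at *
      have inner := run_loop_induction (i := .j) (b := .n) (σ := υ)
        (p := block [set .v (load (add (var .QA) (var .j))),
          ite (load (add (lit 2) (add (var .row) (var .v))))
            (set .k (add (var .k) (sub (sub (var .j) (var .i)) (var .k)))) skip])
        (fun c τ' => τ.reg .k ≤ τ'.reg .k ∧
          (∀ j : Fin n, (j : ℕ) < c → G.Adj (v ⟨i, hi⟩) (v j) → (j : ℕ) - i ≤ τ'.reg .k) ∧
          ∀ k', IsBandwidthOrdering G k' v → τ'.reg .k ≤ k')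
        ⟨a5.ge, by simp, by simpa [a5] using h2⟩ (by
          intro j hj τ' hf' hmem' ⟨j1, j2, j3⟩
          have hmem' := hmem' rfl
          have g1 := hf' .QA rfl
          have g2 := hf' .row rfl
          have g3 := hf' .i rfl
          rw [a3] at g1
          rw [a1] at g2
          rw [a4] at g3
          rw [a6] at hmem'
          rw [a2] at hj
          simp only [run_block_cons, run_block_nil, run_set, eval_load, eval_add, eval_var,
            State.set_reg, State.set_mem, reduceCtorEq, if_false, if_true, g1, hmem', hv ⟨j, hj⟩]
          have hadj : (load (add (lit 2) (add (var .row) (var .v)))).Holds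
              ((τ'.set .j j).set .v (v ⟨j, hj⟩)) ↔ G.Adj (v ⟨i, hi⟩) (v ⟨j, hj⟩) := by
            simp only [holds_load, eval_add, eval_lit, eval_var, State.set_reg, State.set_mem,
              reduceCtorEq, if_false, if_true, g2, hmem']
            exact hG _ _
          by_cases hA : G.Adj (v ⟨i, hi⟩) (v ⟨j, hj⟩)
          · rw [run_ite_of_holds (hadj.mpr hA)]
            simp only [run_set, eval_add, eval_sub, eval_var, State.set_reg, reduceCtorEq, if_false,
              if_true, g3]
            refine ⟨by omega, fun j' hj' hadj' => ?_, fun k' hk' => ?_⟩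
            · rcases Nat.lt_succ_iff_lt_or_eq.mp hj' with h | h
              · have := j2 j' h hadj'
                omega
              · omega
            · have := isBandwidthOrdering_iff.mp hk' _ _ hA
              have := j3 k' hk'
              simp only at *
              omega
          · rw [run_ite_of_not_holds (hadj.not.mpr hA), run_skip]
            simp only [State.set_reg, reduceCtorEq, if_false]
            refine ⟨j1, fun j' hj' hadj' => ?_, j3⟩
            rcases Nat.lt_succ_iff_lt_or_eq.mp hj' with h | h
            · exact j2 j' h hadj'
            · subst h
              exact absurd hadj' hA)
      rw [a2] at inner
      obtain ⟨b1, b2, b3⟩ := inner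
      refine ⟨fun i' j hi' hadj => ?_, b3⟩
      rcases Nat.lt_succ_iff_lt_or_eq.mp hi' with h | h
      · exact (h1 i' j h hadj).trans b1
      · subst h
        exact b2 j j.2 hadj)
  rw [State.set_reg, if_neg (by decide), hn] at key
  obtain ⟨k1, k2⟩ := key
  refine ⟨_, ?_, isBandwidthOrdering_iff.mpr fun i j hij => k1 i j i.2 hij, k2⟩
  simp only [readWidth, run_block_cons, run_block_nil, run_set, eval_add, eval_var, eval_lit,
    State.set_reg, if_true]
  omega

/-! ### Running times -/

/-- The compiled program halts within `T` steps in a configuration that represents the final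
state. -/
def RunsWithin (p : Stmt Var) (σ : State Var) (T : ℕ) : Prop :=
  ∀ c, Represents Var.ctorIdx σ c → ∃ c' t, Exec (p.compile Var.ctorIdx 0) c c' t ∧ t ≤ T ∧
    Represents Var.ctorIdx (p.run σ) c'

theorem Var.ctorIdx_injective : Function.Injective Var.ctorIdx := by
  intro a b h
  cases a <;> cases b <;> first | rfl | cases h

theorem RunsWithin.of_boundedBy {p : Stmt Var} {K : Var → Bool} (hp : p.BoundedBy K = true)
    {σ : State Var} {B c D : ℕ} (hB : ∀ r, K r = true → σ.reg r ≤ B) (hc : p.size ≤ c)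
    (hD : p.depth ≤ D) : RunsWithin p σ (c * (B + 1) ^ D) := by
  intro c hr
  obtain ⟨c', t, h1, h2, h3, -⟩ := exec_compile Var.ctorIdx_injective p hp 0 hB hr
  exact ⟨c', t, h1, h2.trans (Nat.mul_le_mul hc (Nat.pow_le_pow_right (by omega) hD)), h3⟩

theorem RunsWithin.block_nil (σ : State Var) : RunsWithin (block []) σ 1 := fun c hr =>
  ⟨_, _, .const _ _ _, le_rfl, by simpa using hr.setReg_odd 0 0⟩

theorem RunsWithin.block_cons {p : Stmt Var} {l : List (Stmt Var)} {σ : State Var} {T T' : ℕ}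
    (h : RunsWithin p σ T) (h' : RunsWithin (block l) (p.run σ) T') :
    RunsWithin (block (p :: l)) σ (T + T') := by
  intro c hr
  obtain ⟨c₁, t₁, e₁, b₁, r₁⟩ := h c hr
  obtain ⟨c₂, t₂, e₂, b₂, r₂⟩ := h' c₁ r₁
  exact ⟨c₂, _, .seq e₁ e₂, by omega, by simpa using r₂⟩

/-- The program writes neither to the memory nor to the constants other than `m` and `M`. -/
def SetsWidth (p : Stmt Var) : Bool :=
  !p.stores && [Var.n, .s, .nn, .N, .QA, .QH].all (fun r => !p.writes r) &&
    p.BoundedBy (fun r => decide (r = .n))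

/-- A bound for the lengths of the parts of the program. -/
def sizeBound (p : Stmt Var) : ℕ :=
  readHeader.size + setLayout.size + p.size + setPower.size + main.size

/-- A bound for the loop depths of the parts of the program. -/
def depthBound (p : Stmt Var) : ℕ :=
  readHeader.depth + setLayout.depth + p.depth + setPower.depth + main.depth

/-- The loop bounds become known in stages: `n`, then `nn` and `N`, then `m`, then `M`. The generic
time bound requires them to be constant, so it is applied to each stage with its own set of bounding
variables. -/
theorem solvesWithin_program {n k : ℕ} {G : SimpleGraph (Fin n)} {s : Fin n}
    {v : Equiv.Perm (Fin n)} (hG : G.Connected) (hv : IsBandwidthOrdering G k v)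
    {p : Stmt Var} (hp : SetsWidth p = true) {input : List ℕ}
    (hin0 : input.getD 0 0 = n) (hin1 : input.getD 1 0 = s)
    (hin : HoldsGraph G fun a => input.getD a 0)
    (hm : ∀ σ : State Var, σ.reg .n = n → σ.reg .QA = n * n + 2 →
      (σ.mem = fun a => input.getD a 0) → (p.run σ).reg .m = 2 * k + 1) :
    SolvesWithin ((program p).compile Var.ctorIdx 0) input G s
      ((5 * sizeBound p + 1) * ((2 * k + 1) * (n * n * n) ^ (2 * k + 1) + 1) ^ depthBound p) := by
  have hn := s.pos
  simp only [SetsWidth, Bool.and_eq_true, Bool.not_eq_true', List.all_cons, List.all_nil,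
    and_true] at hp
  obtain ⟨⟨p1, p2, p3, p4, p5, p6, p7⟩, p8⟩ := hp
  -- The product dominates both `M` and the window length `2 * k + 1`, the latter also when `n = 1`.
  set B := (2 * k + 1) * (n * n * n) ^ (2 * k + 1) with hB
  have hMB : (n * n * n) ^ (2 * k + 1) ≤ B := Nat.le_mul_of_pos_left _ (by omega)
  have hNB : n * n * n ≤ B := (Nat.le_self_pow (by omega) _).trans hMB
  have hnnB : n * n ≤ B := (Nat.le_mul_of_pos_right _ hn).trans hNB
  have hnB : n ≤ B := (Nat.le_mul_of_pos_right _ hn).trans hnnB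
  have hmB : 2 * k + 1 ≤ B := Nat.le_mul_of_pos_right _ (by positivity)
  set σ₀ : State Var := ⟨fun _ => 0, fun a => input.getD a 0⟩ with hσ₀
  have hr₀ : Represents Var.ctorIdx σ₀ (initConfig input) := ⟨fun _ => rfl, rfl⟩
  have s1 : (readHeader.run σ₀).mem = σ₀.mem := run_mem_of_stores rfl _
  have t1 : RunsWithin readHeader σ₀ (sizeBound p * (B + 1) ^ depthBound p) :=
    .of_boundedBy (K := fun _ => false) rfl (by simp)
      (by simp only [sizeBound]; omega) (by simp only [depthBound]; omega)
  have n1 : (readHeader.run σ₀).reg .n = n := by simpa [readHeader, hσ₀] using hin0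
  have v1 : (readHeader.run σ₀).reg .s = s := by simpa [readHeader, hσ₀] using hin1
  have prog : RunsWithin (program p) σ₀ (sizeBound p * (B + 1) ^ depthBound p +
      (sizeBound p * (B + 1) ^ depthBound p + (sizeBound p * (B + 1) ^ depthBound p +
      (sizeBound p * (B + 1) ^ depthBound p + (sizeBound p * (B + 1) ^ depthBound p + 1))))) ∧
      HoldsOptimalScheme G s ((program p).run σ₀).mem := by
    have hrun : (program p).run σ₀ =
        main.run (setPower.run (p.run (setLayout.run (readHeader.run σ₀)))) := by
      simp only [program, run_block_cons, run_block_nil]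
    rw [hrun]
    have step : ∀ T, RunsWithin (block [setLayout, p, setPower, main]) (readHeader.run σ₀) T →
        RunsWithin (program p) σ₀ (sizeBound p * (B + 1) ^ depthBound p + T) :=
      fun T hT => t1.block_cons hT
    rw [hσ₀] at s1
    generalize readHeader.run σ₀ = σ₁ at *
    have s2 : (setLayout.run σ₁).mem = σ₁.mem := run_mem_of_stores rfl _
    have t2 : RunsWithin setLayout σ₁ (sizeBound p * (B + 1) ^ depthBound p) :=
      .of_boundedBy (K := fun r => decide (r = .n)) rfl
        (fun r hr => by rw [of_decide_eq_true hr, n1]; exact hnB)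
        (by simp only [sizeBound]; omega) (by simp only [depthBound]; omega)
    have n2 : (setLayout.run σ₁).reg .n = n := by rw [run_reg_of_writes rfl, n1]
    have v2 : (setLayout.run σ₁).reg .s = s := by rw [run_reg_of_writes rfl, v1]
    obtain ⟨a1, a2, a3, a4⟩ := run_setLayout n1
    have step₂ : ∀ T, RunsWithin (block [p, setPower, main]) (setLayout.run σ₁) T →
        RunsWithin (block [setLayout, p, setPower, main]) σ₁
          (sizeBound p * (B + 1) ^ depthBound p + T) := fun T hT => t2.block_cons hT
    generalize setLayout.run σ₁ = σ₂ at *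
    have s3 : (p.run σ₂).mem = σ₂.mem := run_mem_of_stores p1 _
    have m3 := hm σ₂ n2 a3 (by rw [s2, s1])
    have t3 : RunsWithin p σ₂ (sizeBound p * (B + 1) ^ depthBound p) :=
      .of_boundedBy p8 (fun r hr => by rw [of_decide_eq_true hr, n2]; exact hnB)
        (by simp only [sizeBound]; omega) (by simp only [depthBound]; omega)
    have step₃ : ∀ T, RunsWithin (block [setPower, main]) (p.run σ₂) T →
        RunsWithin (block [p, setPower, main]) σ₂
          (sizeBound p * (B + 1) ^ depthBound p + T) := fun T hT => t3.block_cons hT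
    have c1 := run_reg_of_writes p2 σ₂
    have c2 := run_reg_of_writes p3 σ₂
    have c3 := run_reg_of_writes p4 σ₂
    have c4 := run_reg_of_writes p5 σ₂
    have c5 := run_reg_of_writes p6 σ₂
    have c6 := run_reg_of_writes p7 σ₂
    generalize p.run σ₂ = σ₃ at *
    have s4 : (setPower.run σ₃).mem = σ₃.mem := run_mem_of_stores rfl _
    have t4 : RunsWithin setPower σ₃ (sizeBound p * (B + 1) ^ depthBound p) :=
      .of_boundedBy (K := fun r => decide (r = .m) || decide (r = .N)) rfl
        (fun r hr => by
          simp only [Bool.or_eq_true, decide_eq_true_eq] at hr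
          rcases hr with rfl | rfl
          · rw [m3]; exact hmB
          · rw [c4, a2]; exact hNB)
        (by simp only [sizeBound]; omega) (by simp only [depthBound]; omega)
    have l4 : Layout n (2 * k + 1) s (setPower.run σ₃) := by
      refine ⟨?_, ?_, ?_, ?_, ?_, ?_, ?_, ?_⟩
      · rw [run_reg_of_writes rfl, c1, n2]
      · rw [run_reg_of_writes rfl, c2, v2]
      · rw [run_reg_of_writes rfl, c3, a1]
      · rw [run_reg_of_writes rfl, c4, a2]
      · rw [run_reg_of_writes rfl, m3]
      · rw [run_setPower, c4, a2, m3]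
      · rw [run_reg_of_writes rfl, c5, a3]
      · rw [run_reg_of_writes rfl, c6, a4]
    have step₄ : ∀ T, RunsWithin (block [main]) (setPower.run σ₃) T →
        RunsWithin (block [setPower, main]) σ₃
          (sizeBound p * (B + 1) ^ depthBound p + T) := fun T hT => t4.block_cons hT
    generalize setPower.run σ₃ = σ₄ at *
    have t5 : RunsWithin main σ₄ (sizeBound p * (B + 1) ^ depthBound p) :=
      .of_boundedBy (K := fun r => decide (r ∈ [Var.n, .nn, .N, .m, .M])) rfl
        (fun r hr => by
          simp only [decide_eq_true_eq, List.mem_cons, List.not_mem_nil, or_false] at hr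
          rcases hr with rfl | rfl | rfl | rfl | rfl
          · rw [l4.reg_n]; exact hnB
          · rw [l4.reg_nn]; exact hnnB
          · rw [l4.reg_N]; exact hNB
          · rw [l4.reg_m]; exact hmB
          · rw [l4.reg_M]; exact hMB)
        (by simp only [sizeBound]; omega) (by simp only [depthBound]; omega)
    refine ⟨step _ (step₂ _ (step₃ _ (step₄ _ (t5.block_cons (.block_nil _))))), ?_⟩
    refine run_main hG hv l4 ?_
    rw [s4, s3, s2, s1]
    exact hin
  obtain ⟨c', t, h1, h2, h3⟩ := prog.1 _ hr₀
  refine ⟨c', t, h1, h2.trans ?_, h3.mem ▸ prog.2⟩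
  have : 1 ≤ (B + 1) ^ depthBound p := Nat.one_le_pow _ _ (by omega)
  rw [Nat.add_mul, Nat.mul_assoc]
  omega

/-! ### The input -/

section Input

variable {n : ℕ} (G : SimpleGraph (Fin n)) (s : Fin n) (l : List ℕ)

theorem getD_encodeInstance_zero : (encodeInstance G s ++ l).getD 0 0 = n := rfl

theorem getD_encodeInstance_one : (encodeInstance G s ++ l).getD 1 0 = s := rfl

theorem holdsGraph_encodeInstance :
    HoldsGraph G fun a => (encodeInstance G s ++ l).getD a 0 := by
  classical
  intro x y
  have hlt : (x * n + y : ℕ) < n * n := by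
    have : ((x : ℕ) + 1) * n ≤ n * n := Nat.mul_le_mul_right n x.2
    rw [Nat.add_mul] at this
    omega
  have hdiv : (⟨x * n + y, hlt⟩ : Fin (n * n)).divNat = x := Fin.ext (mk_div y.2)
  have hmod : (⟨x * n + y, hlt⟩ : Fin (n * n)).modNat = y := Fin.ext (by
    simp [Fin.modNat, Nat.mod_eq_of_lt y.2])
  have : (encodeInstance G s ++ l).getD (2 + (x * n + y)) 0 = if G.Adj x y then 1 else 0 := by
    rw [Nat.add_comm, encodeInstance, List.getD_eq_getElem?_getD, List.append_assoc]
    simp only [List.cons_append, List.nil_append, List.getElem?_cons_succ]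
    rw [List.getElem?_append_left (by simpa using hlt), List.getElem?_ofFn, dif_pos hlt,
      Option.getD_some, hdiv, hmod]
  simp only [this]
  by_cases h : G.Adj x y <;> simp [h]

theorem holdsOrdering_encodeOrdering (v : Equiv.Perm (Fin n)) :
    HoldsOrdering v fun a => (encodeInstance G s ++ encodeOrdering v).getD a 0 := by
  intro i
  simp only [encodeInstance, encodeOrdering]
  rw [List.getD_eq_getElem?_getD, List.append_assoc,
    show n * n + 2 + (i : ℕ) = n * n + i + 2 by omega]
  simp only [List.cons_append, List.nil_append, List.getElem?_cons_succ]
  rw [List.getElem?_append_right (by simp)]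
  simp

end Input

/-! ### The final time bound and the two algorithms. -/

/-- For `k ≥ 1` the exponent `3 * (2 * k' + 1)` is at most `9 * k`. For `k = 0` the target has
exponent `0`, so the bound needs `n = 1`. The factor `2` absorbs the summand `1`. -/
theorem bound_le {n k k' c D : ℕ} (hn : 0 < n) (hk : k' ≤ k) (h0 : k = 0 → n = 1) :
    c * ((2 * k' + 1) * (n * n * n) ^ (2 * k' + 1) + 1) ^ D ≤
      c * (2 * (2 * k + 1)) ^ D * n ^ (9 * D * k) := by
  have h1 : (n * n * n) ^ (2 * k' + 1) ≤ n ^ (9 * k) := by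
    rcases Nat.eq_zero_or_pos k with rfl | hk0
    · simp [h0 rfl]
    · rw [show n * n * n = n ^ 3 by ring, ← pow_mul]
      exact Nat.pow_le_pow_right hn (by omega)
  have h2 : 1 ≤ n ^ (9 * k) := Nat.one_le_pow _ _ hn
  have h3 : (2 * k' + 1) * (n * n * n) ^ (2 * k' + 1) + 1 ≤ 2 * (2 * k + 1) * n ^ (9 * k) := by
    have := Nat.mul_le_mul (show 2 * k' + 1 ≤ 2 * k + 1 by omega) h1
    have : 1 ≤ (2 * k + 1) * n ^ (9 * k) := Nat.one_le_iff_ne_zero.mpr (by positivity)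
    have : 2 * (2 * k + 1) * n ^ (9 * k) = 2 * ((2 * k + 1) * n ^ (9 * k)) := by ring
    omega
  calc _ ≤ c * (2 * (2 * k + 1) * n ^ (9 * k)) ^ D :=
        Nat.mul_le_mul_left _ (Nat.pow_le_pow_left h3 _)
    _ = _ := by rw [mul_pow, ← pow_mul]; ring

/-- With bandwidth `0` the ends of an edge coincide, so there are no edges, whereas any vertex other
than `s` would be adjacent to its caller. -/
theorem eq_one_of_isBandwidthOrdering_zero {n : ℕ} {G : SimpleGraph (Fin n)} (hG : G.Connected)
    (s : Fin n) {v : Equiv.Perm (Fin n)} (hv : IsBandwidthOrdering G 0 v) : n = 1 := by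
  obtain ⟨t, y, h, -⟩ := exists_timing_lt hG s
  have hs : ∀ x, x = s := by
    intro x
    by_contra hx
    have hadj := h.adj x hx
    have h1 := hv (v.symm x) (v.symm (y x)) (by simpa using hadj)
    have h2 : v.symm x = v.symm (y x) := by
      have := abs_le.mp h1
      apply Fin.ext
      omega
    exact hadj.ne (v.symm.injective h2)
  have : Fintype.card (Fin n) = 1 := Fintype.card_eq_one_iff.mpr ⟨s, hs⟩
  simpa using this

theorem exists_bandwidthOrdering {n : ℕ} (G : SimpleGraph (Fin n)) {k : ℕ}
    (hk : bandwidth G ≤ k) : ∃ v, IsBandwidthOrdering G k v := by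
  obtain ⟨v, hv⟩ : bandwidth G ∈ {k | ∃ v : Equiv.Perm (Fin n), IsBandwidthOrdering G k v} :=
    Nat.sInf_mem ⟨n, 1, fun i j _ => by
      rw [abs_le]
      omega⟩
  exact ⟨v, fun i j hij => (hv i j hij).trans (by exact_mod_cast hk)⟩


/-- The program for instances with an ordering. -/
theorem solvesWithin_readWidth {n k : ℕ} {G : SimpleGraph (Fin n)} (s : Fin n)
    {v : Equiv.Perm (Fin n)} (hG : G.Connected) (hv : IsBandwidthOrdering G k v) :
    SolvesWithin ((program readWidth).compile Var.ctorIdx 0)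
      (encodeInstance G s ++ encodeOrdering v) G s
      ((5 * sizeBound readWidth + 1) * (2 * (2 * k + 1)) ^ depthBound readWidth *
        n ^ (9 * depthBound readWidth * k)) := by
  classical
  -- The program works with the least width of the ordering, which may be smaller than the given
  -- `k`.
  have hex : ∃ k, IsBandwidthOrdering G k v := ⟨k, hv⟩
  obtain ⟨τ, t, h1, h2, h3⟩ := solvesWithin_program hG (Nat.find_spec hex) (p := readWidth) rfl
    (getD_encodeInstance_zero G s _) (getD_encodeInstance_one G s _)
    (holdsGraph_encodeInstance G s (encodeOrdering v)) (fun σ hn hQA hmem => by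
      obtain ⟨k', hk', hv', hmin⟩ := run_readWidth (v := v) hn hQA
        (hmem ▸ holdsGraph_encodeInstance G s _) (hmem ▸ holdsOrdering_encodeOrdering G s v)
      rw [hk', le_antisymm (hmin _ (Nat.find_spec hex)) (Nat.find_min' hex hv')])
  refine ⟨τ, t, h1, h2.trans (bound_le s.pos (Nat.find_min' hex hv) ?_), h3⟩
  rintro rfl
  exact eq_one_of_isBandwidthOrdering_zero hG s hv

/-- The program for instances of bandwidth at most `k`. -/
theorem solvesWithin_of_bandwidth_le {n k : ℕ} {G : SimpleGraph (Fin n)} (s : Fin n)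
    (hG : G.Connected) (hk : bandwidth G ≤ k) :
    SolvesWithin ((program (set .m (lit (2 * k + 1)))).compile Var.ctorIdx 0)
      (encodeInstance G s) G s
      ((5 * sizeBound (set .m (lit (2 * k + 1))) + 1) *
        (2 * (2 * k + 1)) ^ depthBound (set .m (lit (2 * k + 1))) *
        n ^ (9 * depthBound (set .m (lit (2 * k + 1))) * k)) := by
  obtain ⟨v, hv⟩ := exists_bandwidthOrdering G hk
  rw [← List.append_nil (encodeInstance G s)]
  obtain ⟨τ, t, h1, h2, h3⟩ := solvesWithin_program hG hv (p := set .m (lit (2 * k + 1))) rfl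
    (getD_encodeInstance_zero G s _) (getD_encodeInstance_one G s _)
    (holdsGraph_encodeInstance G s []) (fun σ _ _ _ => by simp)
  refine ⟨τ, t, h1, h2.trans (bound_le s.pos le_rfl ?_), h3⟩
  rintro rfl
  exact eq_one_of_isBandwidthOrdering_zero hG s hv

end TelephoneBroadcast

open TelephoneBroadcast in
theorem theorem3 :
    (∃ (p : TelephoneBroadcast.Prog) (f : ℕ → ℕ) (C : ℕ),
      ∀ (k n : ℕ) (G : SimpleGraph (Fin n)) (s : Fin n) (v : Equiv.Perm (Fin n)),
        G.Connected → TelephoneBroadcast.IsBandwidthOrdering G k v →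
          TelephoneBroadcast.SolvesWithin p
            (TelephoneBroadcast.encodeInstance G s ++ TelephoneBroadcast.encodeOrdering v) G s
            (f k * n ^ (k ^ 2 + C * k))) ∧
    (∀ k : ℕ, ∃ (p : TelephoneBroadcast.Prog) (a d : ℕ),
      ∀ (n : ℕ) (G : SimpleGraph (Fin n)) (s : Fin n),
        G.Connected → TelephoneBroadcast.bandwidth G ≤ k →
          TelephoneBroadcast.SolvesWithin p
            (TelephoneBroadcast.encodeInstance G s) G s (a * n ^ d)) := by
  refine ⟨?_, fun k => ⟨_, _, _, fun n G s hG hk =>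
    solvesWithin_of_bandwidth_le s hG hk⟩⟩
  refine ⟨(program readWidth).compile Var.ctorIdx 0,
    fun k => (5 * sizeBound readWidth + 1) * (2 * (2 * k + 1)) ^ depthBound readWidth,
    9 * depthBound readWidth, fun k n G s v hG hv => ?_⟩
  obtain ⟨τ, t, h1, h2, h3⟩ := solvesWithin_readWidth s hG hv
  -- The exponent reached is `C * k`; the summand `k ^ 2` is given away.
  exact ⟨τ, t, h1, h2.trans (Nat.mul_le_mul_left _ (Nat.pow_le_pow_right s.pos (by omega))), h3⟩
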